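/- For a nondegenerate triangle $T\subset\mathbb R^2$ with vertices $z_1,z_2,z_3$, let $h_i$ be the length of the edge $e_i$ opposite $z_i$, $\alpha_i$ the interior angle at $z_i$, $|\partial T|=h_1+h_2+h_3$, $h_T=\max_i h_i$, $\rho_T$ the diameter of the incircle of $T$, and $\varrho_T=h_T/\rho_T=\frac{|\partial T|\,h_T}{4|T|}$ its aspect ratio. For $\delta>0$, $T$ satisfies the large angle condition $LAC(\delta)$ if $\alpha_i<\pi-\delta$ for $i=1,2,3$. Let $z_{\rm inc}=\frac1{|\partial T|}(h_1z_1+h_2z_2+h_3z_3)$ be the incenter of $T$, and let $T^{ct}=\{K_1,K_2,K_3\}$ be the Clough--Tocher split of $T$ at $z_{\rm inc}$, where $K_i$ is the triangle spanned by $z_{\rm inc}$ and the edge $e_i$. Let $$\mathring{\boldsymbol P}{}_2^c(T^{ct})=\{v\in [H^1_0(\operatorname{int}T)]^2:\ v|_{K_i}\in [P_2(K_i)]^2,\ i=1,2,3\},$$ where $P_2(K)$ is the space of polynomials of total degree at most $2$ on $K$. Lemma. For every $\delta>0$ there is a constant $C>0$, depending only on $\delta$ (in particular independent of the size and the aspect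 ratio of $T$), such that for every triangle $T$ satisfying $LAC(\delta)$, $$\|\nabla v\|_{L^2(T)}\le C\,\varrho_T\,\|\operatorname{div} v\|_{L^2(T)}\qquad\text{for all } v\in\mathring{\boldsymbol P}{}_2^c(T^{ct}),$$ where $T^{ct}$ is the split of $T$ at its incenter and $\|\nabla v\|_{L^2(T)}$ is formed with the Frobenius norm. -/

import Mathlib

open MeasureTheory Filter Topology
open scoped ContDiff ENNReal

noncomputable section

/-- The Euclidean plane. -/
abbrev Plane : Type := EuclideanSpace ℝ (Fin 2)

/-! ### Sobolev spaces on an open set `D` of the plane -/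

/-- `φ ∈ C_c^∞(D)`. -/
def IsTestFunction (D : Set Plane) (φ : Plane → ℝ) : Prop :=
  ContDiff ℝ ∞ φ ∧ HasCompactSupport φ ∧ tsupport φ ⊆ D

/-- `g` is the weak (distributional) gradient of `u` on `D`:
`∫_D u ∂ⱼφ = - ∫_D gⱼ φ` for all `φ ∈ C_c^∞(D)` and `j = 1, 2`. -/
def HasWeakGradient (D : Set Plane) (u : Plane → ℝ) (g : Plane → Plane) : Prop :=
  LocallyIntegrableOn u D ∧ LocallyIntegrableOn g D ∧
    ∀ φ : Plane → ℝ, IsTestFunction D φ → ∀ j : Fin 2,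
      ∫ x in D, u x * gradient φ x j = - ∫ x in D, g x j * φ x

/-- `H¹(D)`: square integrable functions with a square integrable weak gradient. -/
def sobolevH1 (D : Set Plane) : Set (Plane → ℝ) :=
  {u | MemLp u 2 (volume.restrict D) ∧
    ∃ g : Plane → Plane, HasWeakGradient D u g ∧ MemLp g 2 (volume.restrict D)}

/-- `H¹₀(D)`: the closure of `C_c^∞(D)` in `H¹(D)`. -/
def sobolevH10 (D : Set Plane) : Set (Plane → ℝ) :=
  {u | MemLp u 2 (volume.restrict D) ∧
    ∃ g : Plane → Plane, HasWeakGradient D u g ∧ MemLp g 2 (volume.restrict D) ∧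
      ∃ φ : ℕ → Plane → ℝ, (∀ n, IsTestFunction D (φ n)) ∧
        Tendsto (fun n => eLpNorm (fun x => φ n x - u x) 2 (volume.restrict D)) atTop (𝓝 0) ∧
        Tendsto (fun n => eLpNorm (fun x => gradient (φ n) x - g x) 2 (volume.restrict D))
          atTop (𝓝 0)}

/-! ### Piecewise polynomial spaces on a triangulation `S` (a set of closed triangles) -/

/-- `D = int ⋃_{K ∈ S} K̄`. -/
def meshDomain (S : Set (Set Plane)) : Set Plane :=
  interior (⋃ K ∈ S, closure K)

/-- `P_k(S)`: the functions in `L²(D)` that agree (a.e.) on each `K ∈ S` with a polynomial of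
total degree at most `k`. -/
def piecewisePoly (k : ℕ) (S : Set (Set Plane)) : Set (Plane → ℝ) :=
  {q | MemLp q 2 (volume.restrict (meshDomain S)) ∧
    ∀ K ∈ S, ∃ p : MvPolynomial (Fin 2) ℝ, p.totalDegree ≤ k ∧
      ∀ᵐ x ∂(volume.restrict K), q x = MvPolynomial.eval (fun j => x j) p}

/-- `P_k^c(S) = P_k(S) ∩ H¹(D)`. -/
def conformingPoly (k : ℕ) (S : Set (Set Plane)) : Set (Plane → ℝ) :=
  piecewisePoly k S ∩ sobolevH1 (meshDomain S)

/-- `P_k^c(S) ∩ H¹₀(D)`. -/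
def conformingPolyZero (k : ℕ) (S : Set (Set Plane)) : Set (Plane → ℝ) :=
  conformingPoly k S ∩ sobolevH10 (meshDomain S)

/-- The vector-valued space `[P_k^c(S) ∩ H¹₀(D)]²`. -/
def conformingPolyZeroVec (k : ℕ) (S : Set (Set Plane)) : Set (Plane → Plane) :=
  {v | ∀ i : Fin 2, (fun x => v x i) ∈ conformingPolyZero k S}

/-! ### Triangles -/

/-- The closed triangle spanned by three affinely independent points. -/
def triangleSet (T : Affine.Triangle ℝ Plane) : Set Plane :=
  convexHull ℝ (Set.range T.points)

/-- The length `hᵢ` of the edge `eᵢ` opposite to the vertex `zᵢ`. -/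
def edgeLength (T : Affine.Triangle ℝ Plane) (i : Fin 3) : ℝ :=
  dist (T.points (i + 1)) (T.points (i + 2))

/-- `|∂T|`. -/
def trianglePerimeter (T : Affine.Triangle ℝ Plane) : ℝ :=
  ∑ i : Fin 3, edgeLength T i

/-- `h_T`, the length of the longest edge. -/
def longestEdge (T : Affine.Triangle ℝ Plane) : ℝ :=
  ⨆ i : Fin 3, edgeLength T i

/-- `|T|`. -/
def triangleArea (T : Affine.Triangle ℝ Plane) : ℝ :=
  (volume (triangleSet T)).toReal

/-- The diameter `ρ_T` of the incircle; the inradius is `2|T| / |∂T|`. -/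
def incircleDiameter (T : Affine.Triangle ℝ Plane) : ℝ :=
  4 * triangleArea T / trianglePerimeter T

/-- The aspect ratio `ϱ_T = h_T / ρ_T`. -/
def aspectRatio (T : Affine.Triangle ℝ Plane) : ℝ :=
  longestEdge T / incircleDiameter T

/-- The interior angle `αᵢ` at the vertex `zᵢ`. -/
def triangleAngle (T : Affine.Triangle ℝ Plane) (i : Fin 3) : ℝ :=
  EuclideanGeometry.angle (T.points (i + 1)) (T.points i) (T.points (i + 2))

/-- The large angle condition `LAC(δ)`. -/
def LargeAngleCondition (δ : ℝ) (T : Affine.Triangle ℝ Plane) : Prop :=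
  ∀ i : Fin 3, triangleAngle T i < Real.pi - δ

/-- The incenter `|∂T|⁻¹ (h₁ z₁ + h₂ z₂ + h₃ z₃)`. -/
def triangleIncenter (T : Affine.Triangle ℝ Plane) : Plane :=
  (trianglePerimeter T)⁻¹ • ∑ i : Fin 3, edgeLength T i • T.points i

/-- The Clough–Tocher split of `T` at `z₀`: the three closed triangles `Kᵢ` spanned by `z₀` and
the two endpoints of the edge `eᵢ`. -/
def cloughTocher (T : Affine.Triangle ℝ Plane) (z₀ : Plane) : Set (Set Plane) :=
  Set.range fun i : Fin 3 => convexHull ℝ {z₀, T.points (i + 1), T.points (i + 2)}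

/-! ### Norms of the gradient and the divergence

For `v = (v₁, v₂)`, the function `G i` stands for the weak gradient of the component `vᵢ`. -/

/-- `‖∇v‖_{L²(A)}`, with the Frobenius norm of the matrix with rows `∇vᵢ`. -/
def gradL2Norm (A : Set Plane) (G : Fin 2 → Plane → Plane) : ℝ≥0∞ :=
  eLpNorm (fun x => (WithLp.toLp 2 fun i => G i x : PiLp 2 fun _ : Fin 2 => Plane)) 2
    (volume.restrict A)

/-- `‖div v‖_{L²(A)}`, where `div v = ∂₁v₁ + ∂₂v₂`. -/
def divL2Norm (A : Set Plane) (G : Fin 2 → Plane → Plane) : ℝ≥0∞ :=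
  eLpNorm (fun x => ∑ i : Fin 2, G i x i) 2 (volume.restrict A)

end

/-! The gradient of `v` on each `Kᵢ` is an affine matrix field, so it is bounded by its values at
the two endpoints of `eᵢ` and at the incenter. The divergence is affine on `Kᵢ` too, and `2|Kᵢ| = r
hᵢ` with `r` the inradius. Hence at these three points `hᵢ (div v)² ≤ E = 24 I / r`, where `I` is
the squared norm of the divergence (`sq_vertex_le_lintegral`). What remains is linear algebra
(`clough_tocher_core`): recover matrices from their traces.

At a vertex `zⱼ`, `v` vanishes along both adjacent edges, so each of the two gradients there has
rank one and is determined by the derivative `wⱼ` along the spoke from `zⱼ` to the incenter.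
Continuity across the spoke makes `wⱼ` common to both. The two divergences give the components of
`wⱼ` normal to the two edges, hence `wⱼ` itself. This uses no angle condition and costs the factor
`ϱ_T`.

At the incenter, the trapezoidal rule on a spoke gives the derivative along spoke `j` as `2 w₀ -
wⱼ`, with `w₀` the value of `v` there. The trace on `Kᵢ` then yields the component of `w₀` normal to
`eᵢ`, up to the known `w`'s. Solving for `w₀` is well conditioned at a vertex whose angle is at
least `π/3` and stays away from `π`; the angle condition, in the form `r ≤ K tᵢ` with `tᵢ` the
tangent length (`inradius_le_of_largeAngleCondition`), guarantees this. It also keeps the two spokes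
bounding each `Kᵢ` transversal.

Membership in `H¹₀` gives only almost everywhere statements. Continuity across spokes and vanishing
on the boundary come from extending by zero and from the absence of jumps in a piecewise smooth
function with a weak gradient (`eq_of_weak_gradient_across_line`). -/

/-! ### Plane vector algebra -/

/-- The determinant of two plane vectors. -/
def cross (a b : Plane) : ℝ := a 0 * b 1 - a 1 * b 0

/-- The scalar product of two plane vectors, in coordinates. -/
def dotp (a b : Plane) : ℝ := a 0 * b 0 + a 1 * b 1

/-- The squared Euclidean length, in coordinates. -/
def nsq (a : Plane) : ℝ := a 0 ^ 2 + a 1 ^ 2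

lemma nsq_nonneg (a : Plane) : 0 ≤ nsq a := by unfold nsq; positivity

/-- Cramer's rule writes `cross e f • w` as `cross w f • e - cross w e • f`; the parallelogram law
gives the factor 2, and the defect is the squared length of the sum of the two terms. This recovers
a vector from its components normal to two edges. -/
lemma nsq_mul_cross_sq_le (w e f : Plane) :
    nsq w * cross e f ^ 2 ≤ 2 * (cross w e ^ 2 * nsq f + cross w f ^ 2 * nsq e) := by
  have h : 2 * (cross w e ^ 2 * nsq f + cross w f ^ 2 * nsq e) - nsq w * cross e f ^ 2 =
      (cross w e * f 0 + cross w f * e 0) ^ 2 + (cross w e * f 1 + cross w f * e 1) ^ 2 := by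
    simp only [nsq, cross]; ring
  nlinarith [sq_nonneg (cross w e * f 0 + cross w f * e 0),
    sq_nonneg (cross w e * f 1 + cross w f * e 1)]

lemma nsq_mul_cross_sq_le_dotp (m u v : Plane) :
    nsq m * cross u v ^ 2 ≤ 2 * (dotp m u ^ 2 * nsq v + dotp m v ^ 2 * nsq u) := by
  have h : 2 * (dotp m u ^ 2 * nsq v + dotp m v ^ 2 * nsq u) - nsq m * cross u v ^ 2 =
      (dotp m u * v 0 + dotp m v * u 0) ^ 2 + (dotp m u * v 1 + dotp m v * u 1) ^ 2 := by
    simp only [nsq, cross, dotp]; ring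
  nlinarith [sq_nonneg (dotp m u * v 0 + dotp m v * u 0),
    sq_nonneg (dotp m u * v 1 + dotp m v * u 1)]

lemma cross_sq_le (a b : Plane) : cross a b ^ 2 ≤ nsq a * nsq b := by
  have h : nsq a * nsq b - cross a b ^ 2 = (a 0 * b 0 + a 1 * b 1) ^ 2 := by
    simp only [nsq, cross]; ring
  nlinarith [sq_nonneg (a 0 * b 0 + a 1 * b 1)]

/-- The trace of the matrix with rows `g 0`, `g 1`. -/
def rowTrace (g : Fin 2 → Plane) : ℝ := g 0 0 + g 1 1

/-- The squared Frobenius norm of the matrix with rows `g 0`, `g 1`. -/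
def rowNsq (g : Fin 2 → Plane) : ℝ := nsq (g 0) + nsq (g 1)

lemma rowNsq_nonneg (g : Fin 2 → Plane) : 0 ≤ rowNsq g :=
  add_nonneg (nsq_nonneg _) (nsq_nonneg _)

/-- A matrix acts on the area form as a derivation with factor its trace; here the term with `g e =
0` drops out. -/
lemma cross_eq_rowTrace_mul {g : Fin 2 → Plane} {u e w : Plane}
    (hu : ∀ c, dotp (g c) u = w c) (he : ∀ c, dotp (g c) e = 0) :
    cross w e = rowTrace g * cross u e := by
  have h0 := he 0; have h1 := he 1
  simp only [dotp, rowTrace, cross, ← hu] at *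
  linear_combination (u 1) * h0 - (u 0) * h1

/-- Both rows are multiples of the normal to `e`, so the Frobenius norm is exactly determined by the
image of one transversal vector. -/
lemma rowNsq_mul_cross_sq {g : Fin 2 → Plane} {u e w : Plane}
    (hu : ∀ c, dotp (g c) u = w c) (he : ∀ c, dotp (g c) e = 0) :
    rowNsq g * cross u e ^ 2 = nsq w * nsq e := by
  have key : ∀ c, nsq (g c) * cross u e ^ 2 = w c ^ 2 * nsq e := by
    intro c
    have h0 := he c
    rw [← hu c]
    simp only [dotp, nsq, cross] at *
    have h1 : (g c 0 * (u 0 * e 1 - u 1 * e 0)) = (g c 0 * u 0 + g c 1 * u 1) * e 1 := by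
      linear_combination (-u 1) * h0
    have h2 : (g c 1 * (u 0 * e 1 - u 1 * e 0)) = -(g c 0 * u 0 + g c 1 * u 1) * e 0 := by
      linear_combination (u 0) * h0
    calc _ = (g c 0 * (u 0 * e 1 - u 1 * e 0)) ^ 2 + (g c 1 * (u 0 * e 1 - u 1 * e 0)) ^ 2 := by
          ring
      _ = _ := by rw [h1, h2]; ring
  rw [rowNsq, add_mul, key, key, nsq.eq_def w]; ring

lemma rowTrace_mul_cross {g : Fin 2 → Plane} {u v y y' : Plane}
    (hu : ∀ c, dotp (g c) u = y c) (hv : ∀ c, dotp (g c) v = y' c) :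
    rowTrace g * cross u v = cross y v + cross u y' := by
  simp only [rowTrace, cross, ← hu, ← hv, dotp]; ring

lemma rowNsq_mul_cross_sq_le {g : Fin 2 → Plane} {u v y y' : Plane}
    (hu : ∀ c, dotp (g c) u = y c) (hv : ∀ c, dotp (g c) v = y' c) :
    rowNsq g * cross u v ^ 2 ≤ 2 * (nsq y * nsq v + nsq y' * nsq u) := by
  have h0 := nsq_mul_cross_sq_le_dotp (g 0) u v
  have h1 := nsq_mul_cross_sq_le_dotp (g 1) u v
  rw [hu, hv] at h0 h1
  rw [rowNsq, nsq.eq_def y, nsq.eq_def y']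
  linarith

lemma fin3_add (i : Fin 3) :
    i + 1 + 1 = i + 2 ∧ i + 1 + 2 = i ∧ i + 2 + 1 = i ∧ i + 2 + 2 = i + 1 := by
  revert i; decide

/-! ### The finite-dimensional estimate -/

/-- The constant of the finite-dimensional estimate; `K` bounds (inradius / tangent length). -/
noncomputable def coreConst (K : ℝ) : ℝ :=
  2 * (1 + K ^ 2) * (24 * (1 + K ^ 2) * (1 / 2 + 2 * K * (1 + K ^ 2)) + 2 * K)

set_option maxHeartbeats 1000000 in
-- Dictionary: `z0` is the incenter, `t` the tangent lengths, `r` the inradius, `S` the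
-- semiperimeter. `gA i`, `gB i`, `g0 i` are the gradients on `Kᵢ` at `z (i + 1)`, `z (i + 2)` and
-- `z0`; `w j` is the derivative at `z j` along the spoke, and `w0` the value at `z0`. The unknowns
-- are found in the order `w`, then `w0`, then `g0`.
theorem clough_tocher_core (z : Fin 3 → Plane) (z0 : Plane) (h t : Fin 3 → ℝ) {r S K E H : ℝ}
    (hr : 0 < r) (ht : ∀ i, 0 < t i) (hE : 0 ≤ E)
    (hS : ∀ i, S = t i + t (i + 1) + t (i + 2)) (hh : ∀ i, h i = t (i + 1) + t (i + 2))
    (heron : ∀ i, r ^ 2 * S = t i * t (i + 1) * t (i + 2)) (hK : ∀ i, r ≤ K * t i)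
    (hd : ∀ i, nsq (z0 - z i) = r ^ 2 + t i ^ 2)
    (he : ∀ i, nsq (z (i + 2) - z (i + 1)) = h i ^ 2)
    (hX : ∀ i, cross (z0 - z (i + 1)) (z0 - z (i + 2)) ^ 2 = r ^ 2 * h i ^ 2)
    (hD : ∀ i, cross (z (i + 2) - z (i + 1)) (z i - z (i + 2)) ^ 2 = 4 * r ^ 2 * S ^ 2)
    (hH : ∀ i, h i ≤ H)
    (w0 : Plane) (w : Fin 3 → Plane) (gA gB g0 : Fin 3 → Fin 2 → Plane)
    (hA1 : ∀ i c, dotp (gA i c) (z0 - z (i + 1)) = w (i + 1) c)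
    (hA2 : ∀ i c, dotp (gA i c) (z (i + 2) - z (i + 1)) = 0)
    (hB1 : ∀ i c, dotp (gB i c) (z0 - z (i + 2)) = w (i + 2) c)
    (hB2 : ∀ i c, dotp (gB i c) (z (i + 2) - z (i + 1)) = 0)
    (h01 : ∀ i c, dotp (g0 i c) (z0 - z (i + 1)) = 2 * w0 c - w (i + 1) c)
    (h02 : ∀ i c, dotp (g0 i c) (z0 - z (i + 2)) = 2 * w0 c - w (i + 2) c)
    (hqA : ∀ i, h i * rowTrace (gA i) ^ 2 ≤ E) (hqB : ∀ i, h i * rowTrace (gB i) ^ 2 ≤ E)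
    (hq0 : ∀ i, h i * rowTrace (g0 i) ^ 2 ≤ E) (i : Fin 3) :
    h i * rowNsq (gA i) * r ^ 2 ≤ E * H ^ 2 ∧ h i * rowNsq (gB i) * r ^ 2 ≤ E * H ^ 2 ∧
      h i * rowNsq (g0 i) * r ^ 2 ≤ coreConst K * E * H ^ 2 := by
  have hS0 : 0 < S := by rw [hS 0]; linarith [ht 0, ht (0 + 1), ht (0 + 2)]
  have hh0 : ∀ i, 0 < h i := fun i => by rw [hh]; linarith [ht (i + 1), ht (i + 2)]
  have hhS : ∀ i, h i ≤ S := fun i => by rw [hh, hS i]; linarith [ht i]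
  have hK0 : 0 < K := by
    have := hK 0
    by_contra hc
    nlinarith [ht 0]
  -- Heron's formula with `t i < S`. By the arithmetic-geometric mean inequality, no edge is then
  -- shorter than the incircle diameter.
  have htr : ∀ i, r ^ 2 ≤ t (i + 1) * t (i + 2) := by
    intro i
    have h1 := heron i
    have h2 : t i < S := by rw [hS i]; linarith [ht (i + 1), ht (i + 2)]
    by_contra hc
    push Not at hc
    have h3 : t (i + 1) * t (i + 2) * t i < r ^ 2 * t i := mul_lt_mul_of_pos_right hc (ht i)
    have h4 : r ^ 2 * t i < r ^ 2 * S := mul_lt_mul_of_pos_left h2 (by positivity)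
    nlinarith
  have hh2r : ∀ i, 2 * r ≤ h i := by
    intro i
    have h1 := htr i
    rw [hh]
    have : (2 * r) ^ 2 ≤ (t (i + 1) + t (i + 2)) ^ 2 := by
      nlinarith [sq_nonneg (t (i + 1) - t (i + 2))]
    exact le_of_sq_le_sq this (by linarith [ht (i + 1), ht (i + 2)])
  -- squared distance from the incenter to the vertices
  have hdS : ∀ i, (r ^ 2 + t i ^ 2) * S = h (i + 1) * h (i + 2) * t i := by
    intro i
    obtain ⟨e1, e2, e3, e4⟩ := fin3_add i
    rw [add_mul, heron i, hh, hh, e1, e2, e3, e4, hS i]; ring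
  -- vertex values
  have hXA : ∀ i, cross (z0 - z (i + 1)) (z (i + 2) - z (i + 1)) ^ 2 = r ^ 2 * h i ^ 2 := by
    intro i; rw [← hX i]; simp only [cross, PiLp.sub_apply]; ring
  have hXB : ∀ i, cross (z0 - z (i + 2)) (z (i + 2) - z (i + 1)) ^ 2 = r ^ 2 * h i ^ 2 := by
    intro i; rw [← hX i]; simp only [cross, PiLp.sub_apply]; ring
  have hcA : ∀ i, cross (w (i + 1)) (z (i + 2) - z (i + 1)) ^ 2 ≤ r ^ 2 * h i * E := by
    intro i
    rw [cross_eq_rowTrace_mul (hA1 i) (hA2 i), mul_pow, hXA]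
    have := mul_le_mul_of_nonneg_left (hqA i) (by have := hh0 i; positivity : 0 ≤ r ^ 2 * h i)
    linarith
  have hcB : ∀ i, cross (w (i + 2)) (z (i + 2) - z (i + 1)) ^ 2 ≤ r ^ 2 * h i * E := by
    intro i
    rw [cross_eq_rowTrace_mul (hB1 i) (hB2 i), mul_pow, hXB]
    have := mul_le_mul_of_nonneg_left (hqB i) (by have := hh0 i; positivity : 0 ≤ r ^ 2 * h i)
    linarith
  -- solving at a vertex from the two adjacent edges
  have solve : ∀ (j : Fin 3) (x : Plane) (a b : ℝ),
      cross x (z j - z (j + 2)) ^ 2 ≤ a → cross x (z (j + 1) - z j) ^ 2 ≤ b →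
      nsq x * (2 * r ^ 2 * S ^ 2) ≤ a * h (j + 2) ^ 2 + b * h (j + 1) ^ 2 := by
    intro j x a b ha hb
    obtain ⟨e1, e2, e3, e4⟩ := fin3_add j
    have h1 := nsq_mul_cross_sq_le x (z j - z (j + 2)) (z (j + 1) - z j)
    have h2 := hD (j + 1)
    have h3 := he (j + 1)
    have h4 := he (j + 2)
    rw [e1, e2] at h2 h3
    rw [e3, e4] at h4
    rw [h2, h3, h4] at h1
    nlinarith [mul_le_mul_of_nonneg_right ha (sq_nonneg (h (j + 2))),
      mul_le_mul_of_nonneg_right hb (sq_nonneg (h (j + 1)))]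
  -- The factors `r ^ 2` cancel and `K` does not occur: the vertex gradients are controlled without
  -- the angle condition.
  have hw : ∀ j, nsq (w j) * (2 * S ^ 2) ≤ E * (h (j + 1) * h (j + 2) * (h (j + 1) + h (j + 2))) := by
    intro j
    obtain ⟨e1, e2, e3, e4⟩ := fin3_add j
    have h1 := hcB (j + 1)
    have h2 := hcA (j + 2)
    rw [e1, e2] at h1
    rw [e3, e4] at h2
    have h3 := solve j (w j) _ _ h1 h2
    have : r ^ 2 * (nsq (w j) * (2 * S ^ 2)) ≤
        r ^ 2 * (E * (h (j + 1) * h (j + 2) * (h (j + 1) + h (j + 2)))) := by linarith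
    exact le_of_mul_le_mul_left this (by positivity)
  -- the two vertex gradients
  have hgv : ∀ (i j k : Fin 3), (∀ x y : ℝ, x = h i → y = h k →
      nsq (w j) * (2 * S ^ 2) ≤ E * (x * y * (x + y))) → ∀ g : Fin 2 → Plane,
      rowNsq g * (r ^ 2 * h i ^ 2) = nsq (w j) * h i ^ 2 → h i * rowNsq g * r ^ 2 ≤ E * H ^ 2 := by
    intro i j k hw g hg
    have hw := hw _ _ rfl rfl
    have hi := hh0 i
    have hk := hh0 k
    have h1 : rowNsq g * r ^ 2 = nsq (w j) := by
      have : (rowNsq g * r ^ 2) * h i ^ 2 = nsq (w j) * h i ^ 2 := by rw [← hg]; ring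
      exact mul_right_cancel₀ (by positivity) this
    have h2 : h i * h k * (h i + h k) ≤ h i * (S * (2 * S)) := by
      rw [mul_assoc]
      gcongr
      · exact hhS k
      · linarith [hhS i, hhS k]
    have h3 : nsq (w j) * (2 * S ^ 2) ≤ (E * h i) * (2 * S ^ 2) := by
      have := mul_le_mul_of_nonneg_left h2 hE
      linarith
    have h4 : nsq (w j) ≤ E * h i := le_of_mul_le_mul_right h3 (by positivity)
    calc h i * rowNsq g * r ^ 2 = h i * nsq (w j) := by rw [← h1]; ring
      _ ≤ h i * (E * h i) := by gcongr
      _ = E * h i ^ 2 := by ring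
      _ ≤ E * H ^ 2 := by gcongr; exact hH i
  -- Since `r ^ 2 + t j ^ 2` is the squared spoke length, this bounds the derivative along the unit
  -- spoke. The angle condition trades `1 / t j` for `K / r`.
  have hKt : ∀ j, nsq (w j) ≤ E * K / r * (r ^ 2 + t j ^ 2) := by
    intro j
    have h1 := hw j
    have h2 := hdS j
    have h3 : h (j + 1) + h (j + 2) ≤ 2 * S := by linarith [hhS (j + 1), hhS (j + 2)]
    have htj := ht j
    have h4 : nsq (w j) * (2 * S ^ 2) * t j ≤ E * ((r ^ 2 + t j ^ 2) * S) * (2 * S) := by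
      rw [h2]
      have a := hh0 (j + 1)
      have b := hh0 (j + 2)
      have := mul_le_mul_of_nonneg_left h3
        (by positivity : 0 ≤ E * (h (j + 1) * h (j + 2) * t j))
      have := mul_le_mul_of_nonneg_right h1 htj.le
      linarith
    have h5 : nsq (w j) * t j ≤ E * (r ^ 2 + t j ^ 2) := by
      have : (nsq (w j) * t j) * (2 * S ^ 2) ≤ (E * (r ^ 2 + t j ^ 2)) * (2 * S ^ 2) := by linarith
      exact le_of_mul_le_mul_right this (by positivity)
    rw [div_mul_eq_mul_div, le_div_iff₀ hr]
    calc nsq (w j) * r ≤ nsq (w j) * (K * t j) := by gcongr; exacts [nsq_nonneg _, hK j]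
      _ = K * (nsq (w j) * t j) := by ring
      _ ≤ K * (E * (r ^ 2 + t j ^ 2)) := by gcongr
      _ = _ := by ring
  -- The angle of `Kᵢ` at the incenter is `π/2 + αᵢ/2`, whose squared sine `t i ^ 2 / (r ^ 2 + t i ^
  -- 2)` is at least `1 / (1 + K ^ 2)`. In the proof this is Lagrange's identity for the two spokes,
  -- whose scalar product has modulus `r ^ 2 * h i / t i`.
  have hdd : ∀ i, (r ^ 2 + t (i + 1) ^ 2) * (r ^ 2 + t (i + 2) ^ 2) ≤
      r ^ 2 * h i ^ 2 * (1 + K ^ 2) := by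
    intro i
    have h1 : t (i + 1) * t (i + 2) - r ^ 2 = r ^ 2 * h i / t i := by
      rw [eq_div_iff (ht i).ne', hh]
      have := heron i
      rw [hS i] at this
      linarith
    have h2 : (r ^ 2 + t (i + 1) ^ 2) * (r ^ 2 + t (i + 2) ^ 2) =
        (t (i + 1) * t (i + 2) - r ^ 2) ^ 2 + r ^ 2 * h i ^ 2 := by rw [hh]; ring
    have h3 : r / t i ≤ K := (div_le_iff₀ (ht i)).2 (hK i)
    have h4 : (r / t i) ^ 2 ≤ K ^ 2 := by
      have := ht i
      gcongr
    rw [h2, h1]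
    calc _ = r ^ 2 * h i ^ 2 * (1 + (r / t i) ^ 2) := by ring
      _ ≤ _ := by gcongr
  -- The `1 / 2` comes from the trace term, using `2 r ≤ h i`; the rest from the two spoke
  -- derivatives.
  set B : ℝ := 1 / 2 + 2 * K * (1 + K ^ 2) with hB
  have hB0 : 0 < B := by positivity
  have hw0e : ∀ i, cross w0 (z (i + 2) - z (i + 1)) ^ 2 ≤ 3 / 4 * (E * r * B) * h i ^ 2 := by
    intro i
    have hi := hh0 i
    have h1 := rowTrace_mul_cross (y := 2 • w0 - w (i + 1)) (y' := 2 • w0 - w (i + 2))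
      (fun c => (h01 i c).trans (by simp [two_nsmul, two_mul]))
      (fun c => (h02 i c).trans (by simp [two_nsmul, two_mul]))
    have h2 : 2 * cross w0 (z (i + 2) - z (i + 1)) =
        -(rowTrace (g0 i) * cross (z0 - z (i + 1)) (z0 - z (i + 2))) -
        cross (w (i + 1)) (z0 - z (i + 2)) + cross (w (i + 2)) (z0 - z (i + 1)) := by
      rw [h1]; simp only [cross, PiLp.sub_apply, two_nsmul, PiLp.add_apply]; ring
    have h3 : (rowTrace (g0 i) * cross (z0 - z (i + 1)) (z0 - z (i + 2))) ^ 2 ≤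
        E * r * h i ^ 2 * (1 / 2) := by
      rw [mul_pow, hX]
      have := mul_le_mul_of_nonneg_left (hq0 i) (by positivity : 0 ≤ r ^ 2 * h i)
      have h5 := mul_le_mul_of_nonneg_left (hh2r i) (by positivity : 0 ≤ E * r * h i)
      linarith
    have h4 : ∀ x y, nsq x ≤ E * K / r * (r ^ 2 + t (i + 1) ^ 2) →
        nsq y = (r ^ 2 + t (i + 2) ^ 2) → cross x y ^ 2 ≤ E * r * h i ^ 2 * (K * (1 + K ^ 2)) := by
      intro x y hx hy
      calc cross x y ^ 2 ≤ nsq x * nsq y := cross_sq_le _ _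
        _ ≤ (E * K / r * (r ^ 2 + t (i + 1) ^ 2)) * (r ^ 2 + t (i + 2) ^ 2) := by
          rw [hy]; gcongr
        _ = E * K / r * ((r ^ 2 + t (i + 1) ^ 2) * (r ^ 2 + t (i + 2) ^ 2)) := by ring
        _ ≤ E * K / r * (r ^ 2 * h i ^ 2 * (1 + K ^ 2)) := by exact mul_le_mul_of_nonneg_left (hdd i) (by positivity)
        _ = _ := by field_simp
    have h4' : ∀ x y, nsq x ≤ E * K / r * (r ^ 2 + t (i + 2) ^ 2) →
        nsq y = (r ^ 2 + t (i + 1) ^ 2) → cross x y ^ 2 ≤ E * r * h i ^ 2 * (K * (1 + K ^ 2)) := by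
      intro x y hx hy
      calc cross x y ^ 2 ≤ nsq x * nsq y := cross_sq_le _ _
        _ ≤ (E * K / r * (r ^ 2 + t (i + 2) ^ 2)) * (r ^ 2 + t (i + 1) ^ 2) := by
          rw [hy]; gcongr
        _ = E * K / r * ((r ^ 2 + t (i + 1) ^ 2) * (r ^ 2 + t (i + 2) ^ 2)) := by ring
        _ ≤ E * K / r * (r ^ 2 * h i ^ 2 * (1 + K ^ 2)) := by exact mul_le_mul_of_nonneg_left (hdd i) (by positivity)
        _ = _ := by field_simp
    have h6 := h4 (w (i + 1)) (z0 - z (i + 2)) (hKt _) (hd _)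
    have h7 := h4' (w (i + 2)) (z0 - z (i + 1)) (hKt _) (hd _)
    have h8 : ∀ a b c : ℝ, (-a - b + c) ^ 2 ≤ 3 * (a ^ 2 + b ^ 2 + c ^ 2) := by
      intro a b c
      nlinarith [sq_nonneg (a - b), sq_nonneg (a + c), sq_nonneg (b + c)]
    have h9 := h8 (rowTrace (g0 i) * cross (z0 - z (i + 1)) (z0 - z (i + 2)))
      (cross (w (i + 1)) (z0 - z (i + 2))) (cross (w (i + 2)) (z0 - z (i + 1)))
    rw [← h2] at h9
    rw [hB]
    nlinarith
  have hw0 : nsq w0 ≤ 3 * (1 + K ^ 2) * (E * r * B) := by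
    -- As `t j = r cot (αⱼ/2)`, this picks a vertex with angle at least `π/3`. If there were none,
    -- Heron's formula at the largest `t i`, where `S ≤ 3 t i`, would fail. At a small angle,
    -- solving for `w0` would lose a further factor.
    obtain ⟨j, hj⟩ : ∃ j, t j ^ 2 ≤ 3 * r ^ 2 := by
      by_contra hc
      push Not at hc
      have key : ∀ i, t (i + 1) ≤ t i → t (i + 2) ≤ t i → False := by
        intro i h1 h2
        have h3 : 3 * r ^ 2 < t (i + 1) * t (i + 2) := by
          by_contra h4
          push Not at h4
          have := mul_lt_mul'' (hc (i + 1)) (hc (i + 2)) (by positivity) (by positivity)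
          have h5 : (t (i + 1) * t (i + 2)) ^ 2 ≤ (3 * r ^ 2) ^ 2 := by
            have := ht (i + 1); have := ht (i + 2)
            gcongr
          nlinarith
        have h4 := heron i
        have h5 : S ≤ 3 * t i := by rw [hS i]; linarith
        have h6 := mul_lt_mul_of_pos_left h3 (ht i)
        have h7 := mul_le_mul_of_nonneg_left h5 (sq_nonneg r)
        linarith
      have k0 := key 0; have k1 := key 1; have k2 := key 2
      simp only [Fin.isValue, zero_add, show (1 : Fin 3) + 1 = 2 from rfl,
        show (1 : Fin 3) + 2 = 0 from rfl, show (2 : Fin 3) + 1 = 0 from rfl,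
        show (2 : Fin 3) + 2 = 1 from rfl] at k0 k1 k2
      rcases le_total (t 0) (t 1) with a | a <;> rcases le_total (t 1) (t 2) with b | b <;>
        rcases le_total (t 0) (t 2) with c | c <;>
        first
          | exact k0 (by linarith) (by linarith)
          | exact k1 (by linarith) (by linarith)
          | exact k2 (by linarith) (by linarith)
    obtain ⟨e1, e2, e3, e4⟩ := fin3_add j
    have h1 := hw0e (j + 1)
    have h2 := hw0e (j + 2)
    rw [e1, e2] at h1
    rw [e3, e4] at h2
    have h3 := solve j w0 _ _ h1 h2
    have htj := ht j
    have h4 : nsq w0 * (2 * r ^ 2 * S ^ 2) * t j ^ 2 ≤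
        3 / 2 * (E * r * B) * ((r ^ 2 + t j ^ 2) * S) ^ 2 := by
      rw [hdS j]
      have := mul_le_mul_of_nonneg_right h3 (sq_nonneg (t j))
      linarith
    have h5 : r ^ 2 + t j ^ 2 ≤ (1 + K ^ 2) * t j ^ 2 := by
      have := pow_le_pow_left₀ hr.le (hK j) 2
      linarith
    have h6 : (r ^ 2 + t j ^ 2) ^ 2 ≤ ((1 + K ^ 2) * t j ^ 2) * (4 * r ^ 2) := by
      rw [sq (r ^ 2 + t j ^ 2)]
      gcongr
      linarith
    have h7 : nsq w0 * (2 * r ^ 2 * S ^ 2 * t j ^ 2) ≤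
        (3 * (1 + K ^ 2) * (E * r * B)) * (2 * r ^ 2 * S ^ 2 * t j ^ 2) := by
      have := mul_le_mul_of_nonneg_left h6 (by positivity : 0 ≤ 3 / 2 * (E * r * B) * S ^ 2)
      linarith
    exact le_of_mul_le_mul_right h7 (by positivity)
  -- The incenter gradient satisfies the sharper bound with `h i * r`; it is relaxed to the form
  -- valid at the vertices.
  have hEH : ∀ i, E * h i * r ≤ E * H ^ 2 / 2 := by
    intro i
    have a := hh2r i
    have b := hH i
    have c := hh0 i
    have : h i * r ≤ H ^ 2 / 2 := by nlinarith
    have := mul_le_mul_of_nonneg_left this hE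
    linarith
  refine ⟨?_, ?_, ?_⟩
  · obtain ⟨e1, e2, e3, e4⟩ := fin3_add i
    refine hgv i (i + 1) (i + 2) ?_ (gA i) ?_
    · intro x y hx hy
      have := hw (i + 1)
      rw [e1, e2, ← hx, ← hy] at this
      linarith
    · have := rowNsq_mul_cross_sq (hA1 i) (hA2 i)
      rwa [hXA, he] at this
  · obtain ⟨e1, e2, e3, e4⟩ := fin3_add i
    refine hgv i (i + 2) (i + 1) ?_ (gB i) ?_
    · intro x y hx hy
      have := hw (i + 2)
      rw [e3, e4, ← hx, ← hy] at this
      linarith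
    · have := rowNsq_mul_cross_sq (hB1 i) (hB2 i)
      rwa [hXB, he] at this
  · have h1 := rowNsq_mul_cross_sq_le (y := 2 • w0 - w (i + 1)) (y' := 2 • w0 - w (i + 2))
      (fun c => (h01 i c).trans (by simp [two_nsmul, two_mul]))
      (fun c => (h02 i c).trans (by simp [two_nsmul, two_mul]))
    have hi := hh0 i
    -- From `|2 w0 - w j|² ≤ 8 |w0|² + 2 |w j|²`: the first term is `8 · 3 (1 + K²) B`, the second
    -- `2 K`.
    set F : ℝ := 24 * (1 + K ^ 2) * B + 2 * K with hF
    have h2 : ∀ j, nsq (2 • w0 - w j) ≤ F * E / r * (r ^ 2 + t j ^ 2) := by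
      intro j
      have a : nsq (2 • w0 - w j) ≤ 8 * nsq w0 + 2 * nsq (w j) := by
        simp only [nsq, PiLp.sub_apply, two_nsmul, PiLp.add_apply]
        nlinarith [sq_nonneg (w0 0 + w0 0 + w j 0), sq_nonneg (w0 1 + w0 1 + w j 1)]
      have b : 3 * (1 + K ^ 2) * (E * r * B) ≤
          3 * (1 + K ^ 2) * E * B / r * (r ^ 2 + t j ^ 2) := by
        have : 3 * (1 + K ^ 2) * (E * r * B) = 3 * (1 + K ^ 2) * E * B / r * r ^ 2 := by
          field_simp
        rw [this]
        gcongr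
        nlinarith [ht j]
      have c : F * E / r * (r ^ 2 + t j ^ 2) =
          8 * (3 * (1 + K ^ 2) * E * B / r * (r ^ 2 + t j ^ 2)) +
          2 * (E * K / r * (r ^ 2 + t j ^ 2)) := by rw [hF]; ring
      rw [c]
      linarith [hKt j]
    rw [hX, hd, hd] at h1
    have hF0 : 0 < F := by positivity
    have h3 : rowNsq (g0 i) * (r ^ 2 * h i ^ 2) ≤
        (4 * F * (1 + K ^ 2) * E / r) * (r ^ 2 * h i ^ 2) := by
      have a := mul_le_mul_of_nonneg_right (h2 (i + 1))
        (by positivity : 0 ≤ r ^ 2 + t (i + 2) ^ 2)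
      have b := mul_le_mul_of_nonneg_right (h2 (i + 2))
        (by positivity : 0 ≤ r ^ 2 + t (i + 1) ^ 2)
      have c := mul_le_mul_of_nonneg_left (hdd i) (by positivity : 0 ≤ 4 * (F * E / r))
      have d : 4 * (F * E / r) * (r ^ 2 * h i ^ 2 * (1 + K ^ 2)) =
        (4 * F * (1 + K ^ 2) * E / r) * (r ^ 2 * h i ^ 2) := by ring
      linarith
    have h4 := le_of_mul_le_mul_right h3 (by positivity)
    calc h i * rowNsq (g0 i) * r ^ 2 ≤ h i * (4 * F * (1 + K ^ 2) * E / r) * r ^ 2 := by gcongr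
      _ = 4 * F * (1 + K ^ 2) * (E * h i * r) := by field_simp
      _ ≤ 4 * F * (1 + K ^ 2) * (E * H ^ 2 / 2) := by gcongr; exact hEH i
      _ = _ := by rw [coreConst, ← hB, ← hF]; ring

/-! ### Integration over a triangle -/

lemma lintegral_Icc_ofReal_eq {f F : ℝ → ℝ} {b : ℝ} (hb : 0 ≤ b) (hf : Continuous f)
    (hf0 : ∀ x ∈ Set.Icc 0 b, 0 ≤ f x) (hF : ∀ x, HasDerivAt F (f x) x) :
    ∫⁻ x in Set.Icc 0 b, ENNReal.ofReal (f x) = ENNReal.ofReal (F b - F 0) := by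
  rw [← ofReal_integral_eq_lintegral_ofReal (hf.integrableOn_Icc)
    ((ae_restrict_iff' measurableSet_Icc).2 (ae_of_all _ hf0)), integral_Icc_eq_integral_Ioc,
    ← intervalIntegral.integral_of_le hb,
    intervalIntegral.integral_eq_sub_of_hasDerivAt (fun x _ => hF x)
      (hf.intervalIntegrable _ _)]

/-- The unit triangle in coordinates. -/
def unitTriangle : Set (ℝ × ℝ) := {y | 0 ≤ y.1 ∧ 0 ≤ y.2 ∧ y.1 + y.2 ≤ 1}

lemma isClosed_unitTriangle : IsClosed unitTriangle := by
  have h1 : IsClosed {y : ℝ × ℝ | 0 ≤ y.1} := isClosed_le (by fun_prop) (by fun_prop)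
  have h2 : IsClosed {y : ℝ × ℝ | 0 ≤ y.2} := isClosed_le (by fun_prop) (by fun_prop)
  have h3 : IsClosed {y : ℝ × ℝ | y.1 + y.2 ≤ 1} := isClosed_le (by fun_prop) (by fun_prop)
  exact h1.inter (h2.inter h3)

lemma lintegral_unitTriangle_sq (A B C : ℝ) :
    ∫⁻ y in unitTriangle, ENNReal.ofReal ((A + B * y.1 + C * y.2) ^ 2) =
      ENNReal.ofReal ((6 * A ^ 2 + 4 * A * B + 4 * A * C + B ^ 2 + B * C + C ^ 2) / 12) := by
  rw [← lintegral_indicator isClosed_unitTriangle.measurableSet, Measure.volume_eq_prod,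
    lintegral_prod _ (Measurable.aemeasurable (Measurable.indicator (by fun_prop)
      isClosed_unitTriangle.measurableSet))]
  have inner : ∀ s : ℝ, ∫⁻ t, unitTriangle.indicator
      (fun y : ℝ × ℝ => ENNReal.ofReal ((A + B * y.1 + C * y.2) ^ 2)) (s, t) =
      (Set.Icc (0 : ℝ) 1).indicator (fun s => ENNReal.ofReal ((A + B * s) ^ 2 * (1 - s) +
        (A + B * s) * C * (1 - s) ^ 2 + C ^ 2 * (1 - s) ^ 3 / 3)) s := by
    intro s
    by_cases hs : s ∈ Set.Icc (0 : ℝ) 1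
    · rw [Set.indicator_of_mem hs]
      have h1 : ∀ t, unitTriangle.indicator
          (fun y : ℝ × ℝ => ENNReal.ofReal ((A + B * y.1 + C * y.2) ^ 2)) (s, t) =
          (Set.Icc 0 (1 - s)).indicator
            (fun t => ENNReal.ofReal ((A + B * s + C * t) ^ 2)) t := by
        intro t
        have : (s, t) ∈ unitTriangle ↔ t ∈ Set.Icc 0 (1 - s) := by
          simp only [unitTriangle, Set.mem_ofPred_eq, Set.mem_Icc]
          constructor
          · rintro ⟨_, h2, h3⟩; exact ⟨h2, by linarith⟩
          · rintro ⟨h2, h3⟩; exact ⟨hs.1, h2, by linarith⟩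
        by_cases ht : t ∈ Set.Icc 0 (1 - s)
        · rw [Set.indicator_of_mem ht, Set.indicator_of_mem (this.2 ht)]
        · rw [Set.indicator_of_notMem ht, Set.indicator_of_notMem (fun h => ht (this.1 h))]
      simp_rw [h1]
      rw [lintegral_indicator measurableSet_Icc,
        lintegral_Icc_ofReal_eq (F := fun t => (A + B * s) ^ 2 * t + (A + B * s) * C * t ^ 2 +
          C ^ 2 * t ^ 3 / 3) (by linarith [hs.2]) (by fun_prop) (fun _ _ => sq_nonneg _)]
      · congr 1; ring
      · intro t
        have h := (((hasDerivAt_id t).const_mul ((A + B * s) ^ 2)).add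
          (((hasDerivAt_id t).pow 2).const_mul ((A + B * s) * C))).add
          ((((hasDerivAt_id t).pow 3).const_mul (C ^ 2)).div_const 3)
        refine HasDerivAt.congr_deriv h ?_
        simp; ring
    · rw [Set.indicator_of_notMem hs]
      have h1 : ∀ t, unitTriangle.indicator
          (fun y : ℝ × ℝ => ENNReal.ofReal ((A + B * y.1 + C * y.2) ^ 2)) (s, t) = 0 := by
        intro t
        refine Set.indicator_of_notMem (fun h => hs ?_) _
        exact ⟨h.1, by linarith [h.2.1, h.2.2]⟩
      simp_rw [h1]
      simp
  simp_rw [inner]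
  rw [lintegral_indicator measurableSet_Icc,
    lintegral_Icc_ofReal_eq (F := fun s => A ^ 2 * (s - s ^ 2 / 2) +
      2 * A * B * (s ^ 2 / 2 - s ^ 3 / 3) + B ^ 2 * (s ^ 3 / 3 - s ^ 4 / 4) +
      A * C * (s - s ^ 2 + s ^ 3 / 3) + B * C * (s ^ 2 / 2 - 2 * s ^ 3 / 3 + s ^ 4 / 4) +
      C ^ 2 * (s - 3 * s ^ 2 / 2 + s ^ 3 - s ^ 4 / 4) / 3) zero_le_one (by fun_prop)]
  · congr 1; ring
  · intro s hs
    have h1 : 0 ≤ 1 - s := by linarith [hs.2]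
    have h2 : (A + B * s) ^ 2 * (1 - s) + (A + B * s) * C * (1 - s) ^ 2 +
        C ^ 2 * (1 - s) ^ 3 / 3 = (1 - s) * ((A + B * s + C * (1 - s) / 2) ^ 2 +
          (C * (1 - s)) ^ 2 / 12) := by ring
    rw [h2]; positivity
  · intro s
    have d1 := hasDerivAt_id s
    have d2 := (hasDerivAt_id s).pow 2
    have d3 := (hasDerivAt_id s).pow 3
    have d4 := (hasDerivAt_id s).pow 4
    have h := ((((((d1.sub (d2.div_const 2)).const_mul (A ^ 2)).add
      (((d2.div_const 2).sub (d3.div_const 3)).const_mul (2 * A * B))).add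
      (((d3.div_const 3).sub (d4.div_const 4)).const_mul (B ^ 2))).add
      (((d1.sub d2).add (d3.div_const 3)).const_mul (A * C))).add
      ((((d2.div_const 2).sub ((d3.const_mul 2).div_const 3)).add
        (d4.div_const 4)).const_mul (B * C))).add
      ((((((d1.sub ((d2.const_mul 3).div_const 2)).add d3).sub
        (d4.div_const 4)).const_mul (C ^ 2))).div_const 3)
    refine HasDerivAt.congr_deriv h ?_
    simp; ring

/-- The coordinate identification of `ℝ × ℝ` with the plane. -/
noncomputable def prodPlane : ℝ × ℝ ≃ᵐ Plane :=
  (MeasurableEquiv.finTwoArrow (α := ℝ)).symm.trans (MeasurableEquiv.toLp 2 (Fin 2 → ℝ))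

lemma prodPlane_apply (y : ℝ × ℝ) : prodPlane y = !₂[y.1, y.2] := rfl

lemma measurePreserving_prodPlane : MeasurePreserving prodPlane :=
  ((volume_preserving_finTwoArrow ℝ).symm _).trans (PiLp.volume_preserving_toLp (Fin 2))

/-- The linear map with columns `u`, `v`. -/
noncomputable def columnMap (u v : Plane) : Plane →L[ℝ] Plane :=
  LinearMap.toContinuousLinearMap
    ((LinearMap.proj 0 ∘ₗ (WithLp.linearEquiv 2 ℝ (Fin 2 → ℝ)).toLinearMap).smulRight u +
      (LinearMap.proj 1 ∘ₗ (WithLp.linearEquiv 2 ℝ (Fin 2 → ℝ)).toLinearMap).smulRight v)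

lemma columnMap_apply (u v x : Plane) : columnMap u v x = x 0 • u + x 1 • v := rfl

lemma det_columnMap (u v : Plane) : (columnMap u v).det = cross u v := by
  have : (columnMap u v : Plane →ₗ[ℝ] Plane) =
      Matrix.toLin (EuclideanSpace.basisFun (Fin 2) ℝ).toBasis
        (EuclideanSpace.basisFun (Fin 2) ℝ).toBasis !![u 0, v 0; u 1, v 1] := by
    refine (EuclideanSpace.basisFun (Fin 2) ℝ).toBasis.ext fun i => ?_
    rw [Matrix.toLin_self]
    ext k
    fin_cases i <;> fin_cases k <;> simp [columnMap_apply]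
  rw [ContinuousLinearMap.det, this, LinearMap.det_toLin, Matrix.det_fin_two_of, cross]
  ring

lemma convexHull_triple (p q s : Plane) :
    convexHull ℝ {p, q, s} = (fun x : Plane => p + columnMap (q - p) (s - p) x) ''
      (prodPlane '' unitTriangle) := by
  rw [convexHull_insert (by simp), convexHull_pair]
  ext x
  simp only [mem_convexJoin, Set.mem_singleton_iff, exists_eq_left, Set.mem_image,
    exists_exists_and_eq_and, columnMap_apply, prodPlane_apply]
  constructor
  · rintro ⟨y, hy, hx⟩
    rw [segment_eq_image'] at hy hx
    obtain ⟨a, ha, rfl⟩ := hy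
    obtain ⟨b, hb, rfl⟩ := hx
    refine ⟨(b * (1 - a), b * a), ⟨?_, ?_, ?_⟩, ?_⟩
    · exact mul_nonneg hb.1 (by linarith [ha.2])
    · exact mul_nonneg hb.1 ha.1
    · simp only; linarith [hb.2]
    · ext k; simp; ring
  · rintro ⟨⟨a, b⟩, ⟨ha, hb, hab⟩, rfl⟩
    simp only at ha hb hab
    by_cases h0 : a + b = 0
    · have ha0 : a = 0 := by linarith
      have hb0 : b = 0 := by linarith
      refine ⟨q, left_mem_segment _ _ _, ?_⟩
      simp [ha0, hb0, left_mem_segment]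
    · have hpos : 0 < a + b := lt_of_le_of_ne (by linarith) (Ne.symm h0)
      refine ⟨q + (b / (a + b)) • (s - q), ?_, ?_⟩
      · rw [segment_eq_image']
        exact ⟨_, ⟨by positivity, (div_le_one hpos).2 (by linarith)⟩, rfl⟩
      · rw [segment_eq_image']
        refine ⟨a + b, ⟨hpos.le, hab⟩, ?_⟩
        ext k
        simp
        field_simp
        ring

lemma lintegral_convexHull_triple {p q s : Plane} (h : cross (q - p) (s - p) ≠ 0)
    (f : Plane → ℝ≥0∞) :
    ∫⁻ x in convexHull ℝ {p, q, s}, f x = ENNReal.ofReal |cross (q - p) (s - p)| *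
      ∫⁻ y in unitTriangle, f (p + y.1 • (q - p) + y.2 • (s - p)) := by
  have hm : MeasurableSet (prodPlane '' unitTriangle) :=
    (MeasurableEquiv.measurableSet_image _).2 isClosed_unitTriangle.measurableSet
  have hinj : Function.Injective (fun x : Plane => p + columnMap (q - p) (s - p) x) := by
    intro x y hxy
    have hxy : columnMap (q - p) (s - p) x = columnMap (q - p) (s - p) y := add_left_cancel hxy
    have hker : IsUnit (columnMap (q - p) (s - p) : Plane →ₗ[ℝ] Plane) := by
      rw [LinearMap.isUnit_iff_isUnit_det]
      have := det_columnMap (q - p) (s - p)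
      rw [ContinuousLinearMap.det] at this
      rw [this]
      exact h.isUnit
    exact ((Module.End.isUnit_iff _).1 hker).1 hxy
  rw [convexHull_triple, lintegral_image_eq_lintegral_abs_det_fderiv_mul volume hm
    (fun x _ => ((columnMap (q - p) (s - p)).hasFDerivAt.const_add p).hasFDerivWithinAt)
    hinj.injOn]
  rw [det_columnMap, lintegral_const_mul' _ _ ENNReal.ofReal_ne_top]
  congr 1
  rw [← measurePreserving_prodPlane.setLIntegral_comp_emb prodPlane.measurableEmbedding]
  simp [columnMap_apply, prodPlane_apply, add_assoc]

lemma volume_convexHull_triple {p q s : Plane} (h : cross (q - p) (s - p) ≠ 0) :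
    volume (convexHull ℝ {p, q, s}) = ENNReal.ofReal (|cross (q - p) (s - p)| / 2) := by
  have h1 := lintegral_convexHull_triple h (fun _ => 1)
  have h2 := lintegral_unitTriangle_sq 1 0 0
  simp only [zero_mul, add_zero, one_pow, ENNReal.ofReal_one, mul_zero] at h2
  rw [h2, setLIntegral_one] at h1
  rw [h1, ← ENNReal.ofReal_mul (abs_nonneg _)]
  congr 1
  ring

/-- The integral of the square of an affine function dominates its vertex values. -/
lemma sq_vertex_le_lintegral {p q s : Plane} (h : cross (q - p) (s - p) ≠ 0) {F : Plane → ℝ}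
    (hF : ∀ a b : ℝ, F (p + a • (q - p) + b • (s - p)) = F p + (F q - F p) * a + (F s - F p) * b)
    {x : Plane} (hx : x = p ∨ x = q ∨ x = s) :
    ENNReal.ofReal (|cross (q - p) (s - p)| / 24 * F x ^ 2) ≤
      ∫⁻ y in convexHull ℝ {p, q, s}, ENNReal.ofReal (F y ^ 2) := by
  rw [lintegral_convexHull_triple h]
  simp_rw [hF]
  rw [lintegral_unitTriangle_sq, ← ENNReal.ofReal_mul (abs_nonneg _)]
  apply ENNReal.ofReal_le_ofReal
  rw [div_mul_eq_mul_div, mul_div_assoc]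
  refine mul_le_mul_of_nonneg_left ?_ (abs_nonneg _)
  -- The mass matrix of affine functions in vertex values: each squared vertex value appears with
  -- weight `1 / 24` next to nonnegative terms.
  have key : (6 * F p ^ 2 + 4 * F p * (F q - F p) + 4 * F p * (F s - F p) + (F q - F p) ^ 2 +
      (F q - F p) * (F s - F p) + (F s - F p) ^ 2) / 12 =
      (F p ^ 2 + F q ^ 2 + F s ^ 2 + (F p + F q + F s) ^ 2) / 24 := by ring
  rw [key]
  have h0 := sq_nonneg (F p)
  have h1 := sq_nonneg (F q)
  have h2 := sq_nonneg (F s)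
  have h3 := sq_nonneg (F p + F q + F s)
  rcases hx with rfl | rfl | rfl <;> linarith

/-! ### Jumps of piecewise smooth functions with a weak gradient -/

lemma dotp_gradient (f : Plane → ℝ) (x b : Plane) :
    dotp (gradient f x) b = fderiv ℝ f x b := by
  have h : fderiv ℝ f x b = inner ℝ (gradient f x) b := by
    rw [gradient, InnerProductSpace.toDual_symm_apply]
  rw [h, PiLp.inner_apply, Fin.sum_univ_two, dotp]
  simp [mul_comm]

lemma dotp_sub_left (a b c : Plane) : dotp (a - b) c = dotp a c - dotp b c := by
  simp [dotp]; ring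

lemma dotp_add_right (a b c : Plane) : dotp a (b + c) = dotp a b + dotp a c := by
  simp [dotp]; ring

lemma dotp_smul_right (a b : Plane) (s : ℝ) : dotp a (s • b) = s * dotp a b := by
  simp [dotp]; ring

lemma continuous_dotp {X : Type*} [TopologicalSpace X] {f g : X → Plane} (hf : Continuous f)
    (hg : Continuous g) : Continuous fun x => dotp (f x) (g x) := by
  unfold dotp; fun_prop

/-- The open half plane through `x0` with inner normal `m`. -/
def halfPlane (m x0 : Plane) : Set Plane := {x | 0 < dotp m (x - x0)}

lemma isOpen_halfPlane (m x0 : Plane) : IsOpen (halfPlane m x0) :=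
  isOpen_lt continuous_const (continuous_dotp continuous_const (by fun_prop))

lemma ae_dotp_ne_zero {m : Plane} (hm : m ≠ 0) (x0 : Plane) :
    ∀ᵐ x : Plane, dotp m (x - x0) ≠ 0 := by
  let L : Plane →ₗ[ℝ] ℝ :=
    { toFun := dotp m
      map_add' := dotp_add_right m
      map_smul' := fun s b => dotp_smul_right m b s }
  have hmm : dotp m m ≠ 0 := by
    intro h
    apply hm
    have h' : m 0 * m 0 + m 1 * m 1 = 0 := h
    have h0 : m 0 = 0 := by nlinarith [mul_self_nonneg (m 0), mul_self_nonneg (m 1)]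
    have h1 : m 1 = 0 := by nlinarith [mul_self_nonneg (m 0), mul_self_nonneg (m 1)]
    ext i; fin_cases i <;> simp [h0, h1]
  have hker : LinearMap.ker L ≠ ⊤ := by
    intro h
    exact hmm ((LinearMap.mem_ker (f := L)).1 (h ▸ Submodule.mem_top : m ∈ LinearMap.ker L))
  have h0 : volume ((LinearMap.ker L : Set Plane)) = 0 := Measure.addHaar_submodule _ _ hker
  have h1 := measure_preimage_add_right (volume : Measure Plane) (-x0) (LinearMap.ker L : Set Plane)
  rw [h0] at h1
  rw [ae_iff]
  convert h1 using 2
  ext x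
  simp [L, sub_eq_add_neg]

/-- Integrating a directional derivative over a half plane. -/
lemma integral_halfPlane_fderiv {m a b : Plane} (ha : dotp m a = 0) (hb : dotp m b = 1)
    (hab : cross a b ≠ 0) (x0 : Plane) {f : Plane → ℝ} (hf : ContDiff ℝ ∞ f)
    (hc : HasCompactSupport f) :
    ∫ x in halfPlane m x0, fderiv ℝ f x b = -(|cross a b| * ∫ τ : ℝ, f (x0 + τ • a)) := by
  have hinj : Function.Injective (columnMap a b) := by
    have hker : IsUnit (columnMap a b : Plane →ₗ[ℝ] Plane) := by
      rw [LinearMap.isUnit_iff_isUnit_det]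
      have := det_columnMap a b
      rw [ContinuousLinearMap.det] at this
      rw [this]
      exact hab.isUnit
    exact ((Module.End.isUnit_iff _).1 hker).1
  have hsurj : Function.Surjective (columnMap a b) :=
    LinearMap.surjective_of_injective (f := (columnMap a b : Plane →ₗ[ℝ] Plane)) hinj
  have hdot : ∀ x : Plane, dotp m (columnMap a b x) = x 1 := by
    intro x
    rw [columnMap_apply, dotp_add_right, dotp_smul_right, dotp_smul_right, ha, hb]; ring
  have himg : halfPlane m x0 = (fun x : Plane => x0 + columnMap a b x) '' {x | 0 < x 1} := by
    ext x
    simp only [halfPlane, Set.mem_ofPred_eq, Set.mem_image]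
    constructor
    · intro hx
      obtain ⟨y, hy⟩ := hsurj (x - x0)
      exact ⟨y, by rwa [← hdot, hy], by rw [hy]; abel⟩
    · rintro ⟨y, hy, rfl⟩
      simpa [hdot] using hy
  have hmeas : MeasurableSet {x : Plane | 0 < x 1} :=
    (isOpen_lt continuous_const (by fun_prop)).measurableSet
  rw [himg, integral_image_eq_integral_abs_det_fderiv_smul volume hmeas
    (fun x _ => ((columnMap a b).hasFDerivAt.const_add x0).hasFDerivWithinAt)
    (fun x _ y _ hxy => hinj (add_left_cancel hxy)), det_columnMap]
  simp only [smul_eq_mul]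
  rw [integral_const_mul, ← mul_neg]
  congr 1
  rw [← measurePreserving_prodPlane.setIntegral_preimage_emb prodPlane.measurableEmbedding]
  have hpre : prodPlane ⁻¹' {x : Plane | 0 < x 1} = Set.univ ×ˢ Set.Ioi (0 : ℝ) := by
    ext y; simp [prodPlane_apply]
  have hcont1 : Continuous fun y : ℝ × ℝ => x0 + (y.1 • a + y.2 • b) := by fun_prop
  have hclosed : Topology.IsClosedEmbedding fun y : ℝ × ℝ => x0 + (y.1 • a + y.2 • b) := by
    let Φ : ℝ × ℝ →ₗ[ℝ] Plane := (LinearMap.fst ℝ ℝ ℝ).smulRight a + (LinearMap.snd ℝ ℝ ℝ).smulRight b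
    have hΦ : LinearMap.ker Φ = ⊥ := by
      rw [LinearMap.ker_eq_bot']
      rintro ⟨s, t⟩ h
      have h' : s • a + t • b = 0 := h
      have h2 : columnMap a b !₂[s, t] = columnMap a b 0 := by
        rw [map_zero, columnMap_apply]; simpa using h'
      have h3 := hinj h2
      have e0 := congrArg (fun v : Plane => v 0) h3
      have e1 := congrArg (fun v : Plane => v 1) h3
      simp at e0 e1
      simp [e0, e1]
    exact (Homeomorph.addLeft x0).isClosedEmbedding.comp
      (LinearMap.isClosedEmbedding_of_injective hΦ)
  have hdc : HasCompactSupport fun y : ℝ × ℝ => fderiv ℝ f (x0 + (y.1 • a + y.2 • b)) b :=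
    ((hc.fderiv_apply ℝ b).comp_isClosedEmbedding hclosed)
  have hcd : Continuous fun y : ℝ × ℝ => fderiv ℝ f (x0 + (y.1 • a + y.2 • b)) b :=
    ((hf.continuous_fderiv (by simp)).comp hcont1).clm_apply continuous_const
  rw [hpre]
  have e : ∀ y : ℝ × ℝ, fderiv ℝ f (x0 + columnMap a b (prodPlane y)) b =
      fderiv ℝ f (x0 + (y.1 • a + y.2 • b)) b := by
    intro y; simp [columnMap_apply, prodPlane_apply]
  simp_rw [e]
  rw [Measure.volume_eq_prod, setIntegral_prod _
    (by rw [← Measure.volume_eq_prod]; exact (hcd.integrable_of_hasCompactSupport hdc).integrableOn),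
    Measure.restrict_univ, ← integral_neg]
  congr 1
  ext τ
  have hd : ∀ σ : ℝ, HasDerivAt (fun σ : ℝ => x0 + (τ • a + σ • b)) b σ := by
    intro σ
    have := (((hasDerivAt_id σ).smul_const b).const_add (τ • a)).const_add x0
    rwa [one_smul] at this
  have hd' : ∀ σ : ℝ, deriv (fun σ : ℝ => f (x0 + (τ • a + σ • b))) σ =
      fderiv ℝ f (x0 + (τ • a + σ • b)) b := fun σ =>
    (((hf.differentiable (by simp)) (x0 + (τ • a + σ • b))).hasFDerivAt.comp_hasDerivAt σ
      (hd σ)).deriv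
  have hsm : ContDiff ℝ 1 fun σ : ℝ => f (x0 + (τ • a + σ • b)) :=
    (hf.of_le (by simp)).comp
      (contDiff_const.add (contDiff_const.add (contDiff_id.smul contDiff_const)))
  have hb0 : b ≠ 0 := by
    rintro rfl
    simp [dotp] at hb
  have hline : Topology.IsClosedEmbedding fun σ : ℝ => x0 + (τ • a + σ • b) :=
    (Homeomorph.addLeft x0).isClosedEmbedding.comp
      ((Homeomorph.addLeft (τ • a)).isClosedEmbedding.comp (isClosedEmbedding_smul_left hb0))
  have hcs : HasCompactSupport fun σ : ℝ => f (x0 + (τ • a + σ • b)) :=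
    hc.comp_isClosedEmbedding hline
  have h1 := HasCompactSupport.integral_Ioi_deriv_eq hsm hcs 0
  simp_rw [hd', zero_smul, add_zero] at h1
  exact h1

/-- A piecewise smooth function with a weak gradient has no jump across a line. -/
theorem eq_of_weak_gradient_across_line {m x0 : Plane} (hm : m ≠ 0) {F : Plane → ℝ}
    {Gd : Plane → Plane} {U : Set Plane} (hU : U ∈ 𝓝 x0) {fp fm : Plane → ℝ}
    (hfp : ContDiff ℝ ∞ fp) (hfm : ContDiff ℝ ∞ fm)
    (hp : ∀ᵐ x : Plane, x ∈ U → 0 < dotp m (x - x0) → F x = fp x ∧ Gd x = gradient fp x)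
    (hn : ∀ᵐ x : Plane, x ∈ U → dotp m (x - x0) < 0 → F x = fm x ∧ Gd x = gradient fm x)
    (weak : ∀ ψ : Plane → ℝ, ContDiff ℝ ∞ ψ → HasCompactSupport ψ → ∀ b : Plane,
      ∫ x, F x * fderiv ℝ ψ x b = -∫ x, dotp (Gd x) b * ψ x) :
    fp x0 = fm x0 := by
  -- `a` runs along the line, and `b` is the normal scaled so that the change of coordinates has
  -- determinant of modulus 1.
  set a : Plane := !₂[-m 1, m 0] with ha_def
  set b : Plane := (nsq m)⁻¹ • m with hb_def
  have hm2 : nsq m ≠ 0 := by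
    intro h
    apply hm
    unfold nsq at h
    have h0 : m 0 = 0 := by nlinarith [sq_nonneg (m 0), sq_nonneg (m 1)]
    have h1 : m 1 = 0 := by nlinarith [sq_nonneg (m 0), sq_nonneg (m 1)]
    ext i; fin_cases i <;> simp [h0, h1]
  have ha : dotp m a = 0 := by simp [dotp, ha_def]; ring
  have hb : dotp m b = 1 := by
    rw [hb_def, dotp_smul_right]
    have : dotp m m = nsq m := by simp [dotp, nsq]; ring
    rw [this]; exact inv_mul_cancel₀ hm2
  have hab : cross a b = -1 := by
    have : cross a b = -((nsq m)⁻¹ * nsq m) := by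
      simp [cross, ha_def, hb_def, nsq]; ring
    rw [this, inv_mul_cancel₀ hm2]
  have ha' : dotp (-m) a = 0 := by simp [dotp] at ha ⊢; linarith
  have hb' : dotp (-m) (-b) = 1 := by simpa [dotp] using hb
  have hab' : cross a (-b) = 1 := by
    have : cross a (-b) = -cross a b := by simp [cross]; ring
    rw [this, hab]; simp
  obtain ⟨U', hU'U, hU'o, hxU'⟩ := mem_nhds_iff.1 hU
  obtain ⟨ε, hε, hball⟩ := Metric.isOpen_iff.1 hU'o x0 hxU'
  let η : ContDiffBump x0 := ⟨ε / 4, ε / 2, by positivity, by linarith⟩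
  set d : Plane → ℝ := fun x => fp x - fm x with hd
  have hdc : ContDiff ℝ ∞ d := hfp.sub hfm
  -- The test function is a cutoff times the jump itself: integrating by parts on both half planes
  -- turns the weak identity into a vanishing line integral of `η d²`.
  set ψ : Plane → ℝ := fun x => η x * d x with hψ
  have hψc : ContDiff ℝ ∞ ψ := η.contDiff.mul hdc
  have hψs : HasCompactSupport ψ := η.hasCompactSupport.mul_right
  have hψU : ∀ x, x ∉ U → ψ x = 0 ∧ fderiv ℝ ψ x = 0 := by
    intro x hx
    have : x ∉ tsupport ψ := by
      intro h
      have h1 : x ∈ tsupport η := closure_mono (Function.support_mul_subset_left _ _) h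
      rw [η.tsupport_eq] at h1
      apply hx
      apply hU'U
      apply hball
      rw [Metric.mem_closedBall] at h1
      rw [Metric.mem_ball]
      exact lt_of_le_of_lt h1 (by show ε / 2 < ε; linarith)
    exact ⟨image_eq_zero_of_notMem_tsupport this,
      image_eq_zero_of_notMem_tsupport (fun h => this (tsupport_fderiv_subset ℝ h))⟩
  have hψd : Continuous fun x => fderiv ℝ ψ x b :=
    (hψc.continuous_fderiv (by simp)).clm_apply continuous_const
  have hψds : HasCompactSupport fun x => fderiv ℝ ψ x b := hψs.fderiv_apply ℝ b
  have hcd : ∀ {f : Plane → ℝ}, ContDiff ℝ ∞ f → Continuous fun x => fderiv ℝ f x b :=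
    fun hf => (hf.continuous_fderiv (by simp)).clm_apply continuous_const
  have int1 : ∀ {f : Plane → ℝ}, ContDiff ℝ ∞ f → Integrable fun x => f x * fderiv ℝ ψ x b :=
    fun hf => (hf.continuous.mul hψd).integrable_of_hasCompactSupport hψds.mul_left
  have int2 : ∀ {f : Plane → ℝ}, ContDiff ℝ ∞ f → Integrable fun x => fderiv ℝ f x b * ψ x :=
    fun hf => ((hcd hf).mul hψc.continuous).integrable_of_hasCompactSupport hψs.mul_left
  have mp : MeasurableSet (halfPlane m x0) := (isOpen_halfPlane _ _).measurableSet
  have mn : MeasurableSet (halfPlane (-m) x0) := (isOpen_halfPlane _ _).measurableSet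
  have hneg : ∀ x, x ∈ halfPlane (-m) x0 ↔ dotp m (x - x0) < 0 := by
    intro x
    have : dotp (-m) (x - x0) = - dotp m (x - x0) := by simp [dotp]; ring
    simp only [halfPlane, Set.mem_ofPred_eq, this]
    constructor <;> intro h <;> linarith
  have split : ∀ (A P N : Plane → ℝ), Integrable P → Integrable N →
      (∀ᵐ x, (0 < dotp m (x - x0) → A x = P x) ∧ (dotp m (x - x0) < 0 → A x = N x)) →
      ∫ x, A x = (∫ x in halfPlane m x0, P x) + ∫ x in halfPlane (-m) x0, N x := by
    intro A P N hP hN hA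
    rw [← integral_indicator mp, ← integral_indicator mn,
      ← integral_add (hP.indicator mp) (hN.indicator mn)]
    refine integral_congr_ae ?_
    filter_upwards [hA, ae_dotp_ne_zero hm x0] with x hx hx0
    rcases lt_or_gt_of_ne hx0 with h | h
    · have h1 : x ∉ halfPlane m x0 := fun h' => absurd (show 0 < dotp m (x - x0) from h') (by linarith)
      rw [Set.indicator_of_notMem h1, Set.indicator_of_mem ((hneg x).2 h), hx.2 h, zero_add]
    · have h1 : x ∉ halfPlane (-m) x0 := fun h' => absurd ((hneg x).1 h') (by linarith)
      rw [Set.indicator_of_notMem h1, Set.indicator_of_mem (show x ∈ halfPlane m x0 from h), hx.1 h,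
        add_zero]
  have s1 := split (fun x => F x * fderiv ℝ ψ x b) (fun x => fp x * fderiv ℝ ψ x b)
    (fun x => fm x * fderiv ℝ ψ x b) (int1 hfp) (int1 hfm) (by
      filter_upwards [hp, hn] with x h1 h2
      by_cases hx : x ∈ U
      · exact ⟨fun h => by rw [(h1 hx h).1], fun h => by rw [(h2 hx h).1]⟩
      · simp [(hψU x hx).2])
  have s2 := split (fun x => dotp (Gd x) b * ψ x) (fun x => fderiv ℝ fp x b * ψ x)
    (fun x => fderiv ℝ fm x b * ψ x) (int2 hfp) (int2 hfm) (by
      filter_upwards [hp, hn] with x h1 h2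
      by_cases hx : x ∈ U
      · exact ⟨fun h => by rw [(h1 hx h).2, dotp_gradient],
          fun h => by rw [(h2 hx h).2, dotp_gradient]⟩
      · simp [(hψU x hx).1])
  have hw := weak ψ hψc hψs b
  rw [s1, s2] at hw
  have hprod : ∀ {f : Plane → ℝ}, ContDiff ℝ ∞ f → ∀ x,
      fderiv ℝ (fun y => f y * ψ y) x b = f x * fderiv ℝ ψ x b + fderiv ℝ f x b * ψ x := by
    intro f hf x
    rw [fderiv_fun_mul (hf.differentiable (by simp) x) (hψc.differentiable (by simp) x)]
    simp; ring
  have t1 := integral_halfPlane_fderiv ha hb (by rw [hab]; norm_num) x0 (hfp.mul hψc) hψs.mul_left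
  have t2 := integral_halfPlane_fderiv ha' hb' (by rw [hab']; norm_num) x0 (hfm.mul hψc)
    hψs.mul_left
  simp_rw [map_neg] at t2
  rw [integral_neg] at t2
  simp_rw [hprod hfp] at t1
  simp_rw [hprod hfm] at t2
  rw [integral_add (int1 hfp).integrableOn (int2 hfp).integrableOn] at t1
  rw [integral_add (int1 hfm).integrableOn (int2 hfm).integrableOn] at t2
  rw [hab, abs_neg, abs_one, one_mul] at t1
  rw [hab', abs_one, one_mul] at t2
  have ha0 : a ≠ 0 := by
    intro h
    rw [h] at hab
    simp [cross] at hab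
  have hce : Topology.IsClosedEmbedding fun τ : ℝ => x0 + τ • a :=
    (Homeomorph.addLeft x0).isClosedEmbedding.comp (isClosedEmbedding_smul_left ha0)
  have int3 : ∀ {f : Plane → ℝ}, ContDiff ℝ ∞ f →
      Integrable fun τ : ℝ => f (x0 + τ • a) * ψ (x0 + τ • a) := by
    intro f hf
    have hcs : HasCompactSupport fun x => f x * ψ x := hψs.mul_left
    exact (((hf.continuous.mul hψc.continuous).comp hce.continuous)).integrable_of_hasCompactSupport
      (hcs.comp_isClosedEmbedding hce)
  have hzero : ∫ τ : ℝ, η (x0 + τ • a) * d (x0 + τ • a) ^ 2 = 0 := by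
    have : ∀ τ : ℝ, η (x0 + τ • a) * d (x0 + τ • a) ^ 2 =
        fp (x0 + τ • a) * ψ (x0 + τ • a) - fm (x0 + τ • a) * ψ (x0 + τ • a) := by
      intro τ; simp only [hψ, hd]; ring
    simp_rw [this]
    rw [integral_sub (int3 hfp) (int3 hfm)]
    linarith
  have hcont : Continuous fun τ : ℝ => η (x0 + τ • a) * d (x0 + τ • a) ^ 2 :=
    ((η.contDiff (n := 0)).continuous.comp hce.continuous).mul
      ((hdc.continuous.comp hce.continuous).pow 2)
  have hcs : HasCompactSupport fun τ : ℝ => η (x0 + τ • a) * d (x0 + τ • a) ^ 2 :=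
    (η.hasCompactSupport.comp_isClosedEmbedding hce).mul_right
  have hnn : 0 ≤ fun τ : ℝ => η (x0 + τ • a) * d (x0 + τ • a) ^ 2 :=
    fun τ => mul_nonneg η.nonneg (sq_nonneg _)
  rw [integral_eq_zero_iff_of_nonneg hnn (hcont.integrable_of_hasCompactSupport hcs)] at hzero
  have h0 := congrFun ((hcont.ae_eq_iff_eq volume continuous_zero).1 hzero) 0
  simp only [zero_smul, add_zero, Pi.zero_apply] at h0
  rw [η.one_of_mem_closedBall (Metric.mem_closedBall_self (by show 0 ≤ ε / 4; positivity)),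
    one_mul] at h0
  exact sub_eq_zero.1 (pow_eq_zero_iff (two_ne_zero)|>.1 h0)

/-! ### Weak gradients -/

lemma gradient_apply (f : Plane → ℝ) (x : Plane) (j : Fin 2) :
    gradient f x j = fderiv ℝ f x (EuclideanSpace.single j 1) := by
  rw [← dotp_gradient]
  fin_cases j <;> simp [dotp]

lemma tendsto_integral_mul_of_tendsto_eLpNorm {α : Type*} [MeasurableSpace α] {μ : Measure α}
    {f : ℕ → α → ℝ} {u h : α → ℝ} (hf : ∀ n, MemLp (f n) 2 μ) (hu : MemLp u 2 μ)
    (hh : MemLp h 2 μ) (hlim : Tendsto (fun n => eLpNorm (fun x => f n x - u x) 2 μ) atTop (𝓝 0)) :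
    Tendsto (fun n => ∫ x, f n x * h x ∂μ) atTop (𝓝 (∫ x, u x * h x ∂μ)) := by
  refine tendsto_integral_of_L1' _ (memLp_one_iff_integrable.1 (hh.mul' hu)).1
    (Eventually.of_forall fun n => memLp_one_iff_integrable.1 (hh.mul' (hf n))) ?_
  have hb : ∀ n, eLpNorm ((fun x => f n x * h x) - fun x => u x * h x) 1 μ ≤
      eLpNorm (fun x => f n x - u x) 2 μ * eLpNorm h 2 μ := by
    intro n
    have := eLpNorm_smul_le_mul_eLpNorm (r := 1) (p := 2) (q := 2) hh.1 ((hf n).sub hu).1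
    refine le_trans (le_of_eq ?_) this
    congr 1
    ext x
    simp [sub_mul]
  refine tendsto_of_tendsto_of_tendsto_of_le_of_le tendsto_const_nhds ?_ (fun _ => zero_le)
    (fun n => hb n)
  have := ENNReal.Tendsto.mul_const (b := eLpNorm h 2 μ) hlim (Or.inr hh.2.ne)
  rwa [zero_mul] at this

lemma abs_dotp_le (a b : Plane) : |dotp a b| ≤ ‖b‖ * ‖a‖ := by
  have : dotp a b = inner ℝ a b := by
    rw [PiLp.inner_apply, Fin.sum_univ_two, dotp]; simp [mul_comm]
  rw [this, mul_comm]
  exact abs_real_inner_le_norm a b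

/-- The extension by zero of an `H¹₀` function has a weak gradient on the whole plane. -/
lemma exists_weak_gradient_of_mem_sobolevH10 {D : Set Plane} (hD : MeasurableSet D)
    {u : Plane → ℝ} (hu : u ∈ sobolevH10 D) :
    ∃ g : Plane → Plane, HasWeakGradient D u g ∧
      ∀ ψ : Plane → ℝ, ContDiff ℝ ∞ ψ → HasCompactSupport ψ → ∀ b : Plane,
        ∫ x, D.indicator u x * fderiv ℝ ψ x b = -∫ x, dotp (D.indicator g x) b * ψ x := by
  obtain ⟨hu2, g, hg, hg2, φ, hφ, hlim, hlimg⟩ := hu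
  refine ⟨g, hg, fun ψ hψ hψs b => ?_⟩
  have hcd : ∀ {f : Plane → ℝ}, ContDiff ℝ ∞ f → Continuous fun x => fderiv ℝ f x b :=
    fun hf => (hf.continuous_fderiv (by simp)).clm_apply continuous_const
  have memLp : ∀ {f : Plane → ℝ}, Continuous f → HasCompactSupport f →
      MemLp f 2 (volume.restrict D) := fun hf hs => (hf.memLp_of_hasCompactSupport hs).restrict _
  have hφ1 : ∀ n, MemLp (φ n) 2 (volume.restrict D) :=
    fun n => memLp (hφ n).1.continuous (hφ n).2.1
  have hφ2 : ∀ n, MemLp (fun x => fderiv ℝ (φ n) x b) 2 (volume.restrict D) :=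
    fun n => memLp (hcd (hφ n).1) ((hφ n).2.1.fderiv_apply ℝ b)
  have hψ1 : MemLp ψ 2 (volume.restrict D) := memLp hψ.continuous hψs
  have hψ2 : MemLp (fun x => fderiv ℝ ψ x b) 2 (volume.restrict D) :=
    memLp (hcd hψ) (hψs.fderiv_apply ℝ b)
  have hdm : AEStronglyMeasurable (fun x => dotp (g x) b) (volume.restrict D) :=
    (continuous_dotp continuous_id continuous_const).comp_aestronglyMeasurable hg2.1
  have hg3 : MemLp (fun x => dotp (g x) b) 2 (volume.restrict D) :=
    hg2.of_le_mul (c := ‖b‖) hdm (ae_of_all _ fun x => abs_dotp_le _ _)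
  have hlimb : Tendsto (fun n => eLpNorm (fun x => fderiv ℝ (φ n) x b - dotp (g x) b) 2
      (volume.restrict D)) atTop (𝓝 0) := by
    have hb : ∀ n, eLpNorm (fun x => fderiv ℝ (φ n) x b - dotp (g x) b) 2 (volume.restrict D) ≤
        ENNReal.ofReal ‖b‖ *
          eLpNorm (fun x => gradient (φ n) x - g x) 2 (volume.restrict D) := by
      intro n
      refine eLpNorm_le_mul_eLpNorm_of_ae_le_mul (ae_of_all _ fun x => ?_) _
      rw [← dotp_gradient, ← dotp_sub_left]
      exact abs_dotp_le _ _
    refine tendsto_of_tendsto_of_tendsto_of_le_of_le tendsto_const_nhds ?_ (fun _ => zero_le)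
      (fun n => hb n)
    have := ENNReal.Tendsto.const_mul (a := ENNReal.ofReal ‖b‖) hlimg
      (Or.inr ENNReal.ofReal_ne_top)
    rwa [mul_zero] at this
  have l1 := tendsto_integral_mul_of_tendsto_eLpNorm hφ1 hu2 hψ2 hlim
  have l2 := (tendsto_integral_mul_of_tendsto_eLpNorm hφ2 hg3 hψ1 hlimb).neg
  -- `ψ` need not vanish on the boundary of `D`, but `φ n` is supported in `D`, so integration by
  -- parts over the plane has no boundary term. The identity passes to the limit.
  have heq : ∀ n, ∫ x in D, φ n x * fderiv ℝ ψ x b = -∫ x in D, fderiv ℝ (φ n) x b * ψ x := by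
    intro n
    have hout : ∀ x, x ∉ D → φ n x = 0 ∧ fderiv ℝ (φ n) x = 0 := by
      intro x hx
      have hx' : x ∉ tsupport (φ n) := fun h => hx ((hφ n).2.2 h)
      exact ⟨image_eq_zero_of_notMem_tsupport hx',
        image_eq_zero_of_notMem_tsupport (fun h => hx' (tsupport_fderiv_subset ℝ h))⟩
    rw [setIntegral_eq_integral_of_forall_compl_eq_zero (fun x hx => by simp [(hout x hx).1]),
      setIntegral_eq_integral_of_forall_compl_eq_zero (fun x hx => by simp [(hout x hx).2])]
    refine integral_mul_fderiv_eq_neg_fderiv_mul_of_integrable ?_ ?_ ?_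
      (fun x _ => (hφ n).1.differentiable (by simp) x) (fun x _ => hψ.differentiable (by simp) x)
    · exact ((hcd (hφ n).1).mul hψ.continuous).integrable_of_hasCompactSupport hψs.mul_left
    · exact ((hφ n).1.continuous.mul (hcd hψ)).integrable_of_hasCompactSupport
        (hφ n).2.1.mul_right
    · exact ((hφ n).1.continuous.mul hψ.continuous).integrable_of_hasCompactSupport hψs.mul_left
  simp_rw [heq] at l1
  have := tendsto_nhds_unique l1 l2
  rw [← integral_indicator hD, ← integral_indicator hD] at this
  have e1 : ∀ x, D.indicator u x * fderiv ℝ ψ x b =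
      D.indicator (fun x => u x * fderiv ℝ ψ x b) x := by
    intro x; by_cases hx : x ∈ D <;> simp [hx]
  have e2 : ∀ x, dotp (D.indicator g x) b * ψ x =
      D.indicator (fun x => dotp (g x) b * ψ x) x := by
    intro x; by_cases hx : x ∈ D <;> simp [hx, dotp]
  simp_rw [e1, e2]
  exact this

/-- The weak gradient of a locally smooth function is its gradient. -/
lemma weak_gradient_ae_eq_gradient {D O : Set Plane} (hO : IsOpen O) (hOD : O ⊆ D)
    {u : Plane → ℝ} {g : Plane → Plane} (hg : HasWeakGradient D u g) {f : Plane → ℝ}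
    (hf : ContDiff ℝ ∞ f) (huf : ∀ᵐ x : Plane, x ∈ O → u x = f x) :
    ∀ᵐ x : Plane, x ∈ O → g x = gradient f x := by
  obtain ⟨-, hgl, hw⟩ := hg
  have hgf : ∀ j, Continuous fun x => gradient f x j := by
    intro j
    simp_rw [gradient_apply]
    exact (hf.continuous_fderiv (by simp)).clm_apply continuous_const
  have hcomp : ∀ j : Fin 2, LocallyIntegrableOn (fun x => g x j) O := by
    intro j x hx
    obtain ⟨s, hs, hi⟩ := hgl x (hOD hx)
    refine ⟨s, nhdsWithin_mono x hOD hs, ?_⟩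
    exact (EuclideanSpace.proj j : Plane →L[ℝ] ℝ).integrable_comp hi
  have key : ∀ j : Fin 2, ∀ᵐ x : Plane, x ∈ O → g x j - gradient f x j = 0 := by
    intro j
    refine hO.ae_eq_zero_of_integral_contDiff_smul_eq_zero
      ((hcomp j).sub ((hgf j).locallyIntegrable.locallyIntegrableOn O)) ?_
    intro φ hφ hφs hφO
    have h1 := hw φ ⟨hφ, hφs, hφO.trans hOD⟩ j
    have hout : ∀ x, x ∉ O → φ x = 0 ∧ gradient φ x j = 0 := by
      intro x hx
      have hx' : x ∉ tsupport φ := fun h => hx (hφO h)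
      refine ⟨image_eq_zero_of_notMem_tsupport hx', ?_⟩
      rw [gradient_apply,
        image_eq_zero_of_notMem_tsupport (fun h => hx' (tsupport_fderiv_subset ℝ h))]
      rfl
    rw [setIntegral_eq_integral_of_forall_compl_eq_zero
        (fun x hx => by simp [(hout x (fun h => hx (hOD h))).2]),
      setIntegral_eq_integral_of_forall_compl_eq_zero
        (fun x hx => by simp [(hout x (fun h => hx (hOD h))).1])] at h1
    have h2 : ∫ x, u x * gradient φ x j = ∫ x, f x * gradient φ x j := by
      refine integral_congr_ae ?_
      filter_upwards [huf] with x hx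
      by_cases hxO : x ∈ O
      · rw [hx hxO]
      · simp [(hout x hxO).2]
    have h3 : ∫ x, f x * gradient φ x j = -∫ x, gradient f x j * φ x := by
      simp_rw [gradient_apply]
      refine integral_mul_fderiv_eq_neg_fderiv_mul_of_integrable ?_ ?_ ?_
        (fun x _ => hf.differentiable (by simp) x) (fun x _ => hφ.differentiable (by simp) x)
      · exact (((hf.continuous_fderiv (by simp)).clm_apply continuous_const).mul
          hφ.continuous).integrable_of_hasCompactSupport hφs.mul_left
      · exact (hf.continuous.mul ((hφ.continuous_fderiv (by simp)).clm_apply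
          continuous_const)).integrable_of_hasCompactSupport (hφs.fderiv_apply ℝ _).mul_left
      · exact (hf.continuous.mul hφ.continuous).integrable_of_hasCompactSupport hφs.mul_left
    have i1 : Integrable fun x => φ x • g x j := by
      have hK := (hcomp j).integrableOn_compact_subset hφO hφs
      have := hK.continuousOn_smul hφ.continuous.continuousOn hφs
      refine (integrableOn_iff_integrable_of_support_subset ?_).1 this
      intro x hx
      refine subset_tsupport φ ?_
      intro h0
      exact hx (by simp [h0])
    have i2 : Integrable fun x => φ x • gradient f x j :=
      (hφ.continuous.smul (hgf j)).integrable_of_hasCompactSupport hφs.smul_right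
    simp_rw [smul_sub]
    rw [integral_sub i1 i2]
    simp_rw [smul_eq_mul, mul_comm (φ _)]
    linarith
  filter_upwards [key 0, key 1] with x h0 h1 hx
  ext j
  fin_cases j
  · exact sub_eq_zero.1 (h0 hx)
  · exact sub_eq_zero.1 (h1 hx)

/-! ### Quadratic functions on the plane -/

/-- The quadratic function with coefficients `a`. -/
def quad (a : Fin 6 → ℝ) (x : Plane) : ℝ :=
  a 0 + a 1 * x 0 + a 2 * x 1 + a 3 * x 0 ^ 2 + a 4 * (x 0 * x 1) + a 5 * x 1 ^ 2

/-- The gradient of `quad a`. -/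
noncomputable def quadGrad (a : Fin 6 → ℝ) (x : Plane) : Plane :=
  !₂[a 1 + 2 * a 3 * x 0 + a 4 * x 1, a 2 + a 4 * x 0 + 2 * a 5 * x 1]

lemma quad_add (a b : Fin 6 → ℝ) (x : Plane) : quad (a + b) x = quad a x + quad b x := by
  simp [quad]; ring

lemma quad_sub (a b : Fin 6 → ℝ) (x : Plane) : quad (a - b) x = quad a x - quad b x := by
  simp [quad]; ring

lemma quadGrad_sub (a b : Fin 6 → ℝ) (x : Plane) :
    quadGrad (a - b) x = quadGrad a x - quadGrad b x := by
  ext i; fin_cases i <;> simp [quadGrad] <;> ring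

lemma quad_zero (x : Plane) : quad 0 x = 0 := by simp [quad]

lemma exists_quad_of_totalDegree_le_two (p : MvPolynomial (Fin 2) ℝ) (hp : p.totalDegree ≤ 2) :
    ∃ a : Fin 6 → ℝ, ∀ x : Plane, MvPolynomial.eval (fun j => x j) p = quad a x := by
  have key : ∀ s : Finset (Fin 2 →₀ ℕ), (∀ m ∈ s, m 0 + m 1 ≤ 2) → ∃ a : Fin 6 → ℝ, ∀ x : Plane,
      ∑ m ∈ s, p.coeff m * (x 0 ^ m 0 * x 1 ^ m 1) = quad a x := by
    classical
    intro s
    induction s using Finset.induction_on with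
    | empty => exact fun _ => ⟨0, fun x => by simp [quad_zero]⟩
    | insert m s hm ih =>
      intro h
      obtain ⟨a, ha⟩ := ih fun m' hm' => h m' (Finset.mem_insert_of_mem hm')
      have hmm := h m (Finset.mem_insert_self _ _)
      suffices ∃ b : Fin 6 → ℝ, ∀ x : Plane,
          p.coeff m * (x 0 ^ m 0 * x 1 ^ m 1) = quad b x by
        obtain ⟨b, hb⟩ := this
        exact ⟨b + a, fun x => by rw [Finset.sum_insert hm, ha, hb, quad_add]⟩
      generalize p.coeff m = c
      generalize m 0 = k at hmm ⊢
      generalize m 1 = l at hmm ⊢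
      have hk : k ≤ 2 := by omega
      interval_cases k
      · have hl : l ≤ 2 := by omega
        interval_cases l
        · exact ⟨![c, 0, 0, 0, 0, 0], fun x => by simp [quad]⟩
        · exact ⟨![0, 0, c, 0, 0, 0], fun x => by simp [quad]⟩
        · exact ⟨![0, 0, 0, 0, 0, c], fun x => by simp [quad]⟩
      · have hl : l ≤ 1 := by omega
        interval_cases l
        · exact ⟨![0, c, 0, 0, 0, 0], fun x => by simp [quad]⟩
        · exact ⟨![0, 0, 0, 0, c, 0], fun x => by simp [quad]⟩
      · have hl : l = 0 := by omega
        subst hl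
        exact ⟨![0, 0, 0, c, 0, 0], fun x => by simp [quad]⟩
  obtain ⟨a, ha⟩ := key p.support fun m hm => by
    have := MvPolynomial.le_totalDegree hm
    rw [Finsupp.sum_fintype _ _ (fun _ => rfl), Fin.sum_univ_two] at this
    omega
  refine ⟨a, fun x => ?_⟩
  rw [MvPolynomial.eval_eq', ← ha]
  simp [Fin.prod_univ_two]

lemma contDiff_quad (a : Fin 6 → ℝ) : ContDiff ℝ ∞ (quad a) := by
  unfold quad; fun_prop

lemma quad_add_smul (a : Fin 6 → ℝ) (x v : Plane) (s : ℝ) :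
    quad a (x + s • v) = quad a x + dotp (quadGrad a x) v * s +
      (a 3 * v 0 ^ 2 + a 4 * (v 0 * v 1) + a 5 * v 1 ^ 2) * s ^ 2 := by
  simp [quad, quadGrad, dotp]; ring

lemma gradient_quad (a : Fin 6 → ℝ) (x : Plane) : gradient (quad a) x = quadGrad a x := by
  have key : ∀ v : Plane, fderiv ℝ (quad a) x v = dotp (quadGrad a x) v := by
    intro v
    rw [← ((contDiff_quad a).differentiable (by simp) x).lineDeriv_eq_fderiv]
    unfold lineDeriv
    simp_rw [quad_add_smul]
    have h := (((hasDerivAt_id (0 : ℝ)).const_mul (dotp (quadGrad a x) v)).const_add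
      (quad a x)).add (((hasDerivAt_id (0 : ℝ)).pow 2).const_mul
        (a 3 * v 0 ^ 2 + a 4 * (v 0 * v 1) + a 5 * v 1 ^ 2))
    refine (HasDerivAt.deriv (h.congr_deriv ?_))
    simp
  ext j
  rw [gradient_apply, key]
  fin_cases j <;> simp [dotp]

/-- The trapezoidal rule is exact for the derivative of a quadratic. -/
lemma quad_sub_quad (a : Fin 6 → ℝ) (x y : Plane) :
    2 * (quad a y - quad a x) = dotp (quadGrad a x) (y - x) + dotp (quadGrad a y) (y - x) := by
  simp [quad, quadGrad, dotp]; ring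

lemma quadGrad_affine (a : Fin 6 → ℝ) (p q s : Plane) (α β : ℝ) :
    quadGrad a (p + α • (q - p) + β • (s - p)) =
      quadGrad a p + α • (quadGrad a q - quadGrad a p) + β • (quadGrad a s - quadGrad a p) := by
  ext i; fin_cases i <;> simp [quadGrad] <;> ring

/-- A quadratic vanishing on an open segment vanishes on the line, with its derivative. -/
lemma quad_eq_zero_of_segment {a : Fin 6 → ℝ} {x y : Plane}
    (h : ∀ s : ℝ, 0 < s → s < 1 → quad a (x + s • (y - x)) = 0) :
    quad a x = 0 ∧ quad a y = 0 ∧ dotp (quadGrad a x) (y - x) = 0 ∧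
      dotp (quadGrad a y) (y - x) = 0 := by
  -- Three zeros annihilate a quadratic in the parameter `s`.
  have h1 := h (1 / 4) (by norm_num) (by norm_num)
  have h2 := h (1 / 2) (by norm_num) (by norm_num)
  have h3 := h (3 / 4) (by norm_num) (by norm_num)
  rw [quad_add_smul] at h1 h2 h3
  have h4 := quad_add_smul a x (y - x) 1
  rw [one_smul, add_sub_cancel] at h4
  have h5 := quad_sub_quad a x y
  refine ⟨?_, ?_, ?_, ?_⟩ <;> linarith

/-! ### The geometry of a triangle and its incenter -/

section Geometry

variable (T : Affine.Triangle ℝ Plane)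

/-- Twice the signed area. -/
def signedArea2 : ℝ := cross (T.points 1 - T.points 0) (T.points 2 - T.points 0)

lemma cross_points (i : Fin 3) :
    cross (T.points (i + 1) - T.points i) (T.points (i + 2) - T.points i) = signedArea2 T := by
  fin_cases i
  · rfl
  · show cross (T.points 2 - T.points 1) (T.points 0 - T.points 1) = _
    simp [signedArea2, cross]; ring
  · show cross (T.points 0 - T.points 2) (T.points 1 - T.points 2) = _
    simp [signedArea2, cross]; ring

lemma signedArea2_ne_zero : signedArea2 T ≠ 0 := by
  intro h
  have hT := (affineIndependent_iff.1 T.independent) Finset.univ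
  have key : ∀ c d : ℝ, c • (T.points 1 - T.points 0) + d • (T.points 2 - T.points 0) = 0 →
      c = 0 ∧ d = 0 := by
    intro c d hcd
    have := hT ![-(c + d), c, d] (by simp [Fin.sum_univ_three]) (by
      rw [← hcd]; simp [Fin.sum_univ_three]; module)
    exact ⟨this 1 (Finset.mem_univ _), this 2 (Finset.mem_univ _)⟩
  unfold signedArea2 cross at h
  set u := T.points 1 - T.points 0
  set v := T.points 2 - T.points 0
  obtain ⟨e1, e2⟩ := key (v 0) (-u 0) (by
    ext k; fin_cases k <;> simp <;> linarith)
  obtain ⟨e3, e4⟩ := key (v 1) (-u 1) (by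
    ext k; fin_cases k <;> simp <;> linarith)
  have hu : u = 0 := by
    ext k; fin_cases k <;> simp <;> linarith
  have := (key 1 0 (by rw [hu]; simp)).1
  norm_num at this

lemma edgeLength_sq (i : Fin 3) :
    edgeLength T i ^ 2 = nsq (T.points (i + 2) - T.points (i + 1)) := by
  rw [edgeLength, dist_comm, EuclideanSpace.dist_eq, Real.sq_sqrt (by positivity),
    Fin.sum_univ_two, nsq, Real.dist_eq, Real.dist_eq, sq_abs, sq_abs]
  rfl

lemma edgeLength_nonneg (i : Fin 3) : 0 ≤ edgeLength T i := dist_nonneg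

lemma trianglePerimeter_eq (i : Fin 3) :
    trianglePerimeter T = edgeLength T i + edgeLength T (i + 1) + edgeLength T (i + 2) := by
  rw [trianglePerimeter, Fin.sum_univ_three]
  fin_cases i
  · rfl
  · show _ = edgeLength T 1 + edgeLength T 2 + edgeLength T 0
    ring
  · show _ = edgeLength T 2 + edgeLength T 0 + edgeLength T 1
    ring

/-! ### Tangent lengths, Heron's formula and the incenter -/

/-- The distance from the vertex `zᵢ` to the adjacent points of tangency of the incircle. -/
noncomputable def tangentLength (i : Fin 3) : ℝ :=
  (edgeLength T (i + 1) + edgeLength T (i + 2) - edgeLength T i) / 2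

/-- The inradius. -/
noncomputable def inradius : ℝ := |signedArea2 T| / trianglePerimeter T

lemma edgeLength_eq (i : Fin 3) :
    edgeLength T i = tangentLength T (i + 1) + tangentLength T (i + 2) := by
  obtain ⟨e1, e2, e3, e4⟩ := fin3_add i
  simp only [tangentLength, e1, e2, e3, e4]; ring

lemma semiperimeter_eq (i : Fin 3) : trianglePerimeter T / 2 =
    tangentLength T i + tangentLength T (i + 1) + tangentLength T (i + 2) := by
  obtain ⟨e1, e2, e3, e4⟩ := fin3_add i
  rw [trianglePerimeter_eq T i]
  simp only [tangentLength, e1, e2, e3, e4]; ring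

lemma dotp_edges (i : Fin 3) :
    dotp (T.points (i + 1) - T.points i) (T.points (i + 2) - T.points i) =
      (edgeLength T (i + 1) ^ 2 + edgeLength T (i + 2) ^ 2 - edgeLength T i ^ 2) / 2 := by
  obtain ⟨e1, e2, e3, e4⟩ := fin3_add i
  simp only [edgeLength_sq, e1, e2, e3, e4, nsq, dotp, PiLp.sub_apply]; ring

/-- Heron's formula, from Lagrange's identity and the law of cosines. With the area nonzero, it
upgrades the triangle inequality to strict positivity of the tangent lengths. -/
lemma signedArea2_sq (i : Fin 3) : signedArea2 T ^ 2 = 4 * (trianglePerimeter T / 2) *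
    (tangentLength T i * tangentLength T (i + 1) * tangentLength T (i + 2)) := by
  obtain ⟨e1, e2, e3, e4⟩ := fin3_add i
  have h1 : signedArea2 T ^ 2 = edgeLength T (i + 2) ^ 2 * edgeLength T (i + 1) ^ 2 -
      dotp (T.points (i + 1) - T.points i) (T.points (i + 2) - T.points i) ^ 2 := by
    rw [← cross_points T i]
    simp only [edgeLength_sq, e1, e2, e3, e4, nsq, dotp, cross, PiLp.sub_apply]; ring
  rw [h1, dotp_edges, trianglePerimeter_eq T i]
  simp only [tangentLength, e1, e2, e3, e4]; ring

lemma tangentLength_nonneg (i : Fin 3) : 0 ≤ tangentLength T i := by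
  obtain ⟨e1, e2, e3, e4⟩ := fin3_add i
  have h := dist_triangle (T.points (i + 1)) (T.points i) (T.points (i + 2))
  rw [dist_comm (T.points (i + 1)) (T.points i)] at h
  simp only [tangentLength, edgeLength, e1, e2, e3, e4]
  rw [dist_comm (T.points (i + 2)) (T.points i)]
  linarith

lemma tangentLength_pos (i : Fin 3) : 0 < tangentLength T i := by
  refine lt_of_le_of_ne (tangentLength_nonneg T i) fun h => ?_
  have := signedArea2_sq T i
  rw [← h] at this
  exact signedArea2_ne_zero T (by simpa using this)

lemma edgeLength_pos (i : Fin 3) : 0 < edgeLength T i := by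
  rw [edgeLength_eq]; linarith [tangentLength_pos T (i + 1), tangentLength_pos T (i + 2)]

lemma trianglePerimeter_pos : 0 < trianglePerimeter T := by
  rw [trianglePerimeter_eq T 0]
  linarith [edgeLength_pos T 0, edgeLength_pos T (0 + 1), edgeLength_pos T (0 + 2)]

lemma inradius_pos : 0 < inradius T :=
  div_pos (abs_pos.2 (signedArea2_ne_zero T)) (trianglePerimeter_pos T)

lemma inradius_sq_mul (i : Fin 3) : inradius T ^ 2 * (trianglePerimeter T / 2) =
    tangentLength T i * tangentLength T (i + 1) * tangentLength T (i + 2) := by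
  have hP := trianglePerimeter_pos T
  have h := signedArea2_sq T i
  rw [inradius, div_pow, sq_abs, h]
  field_simp
  ring

lemma triangleIncenter_eq (i : Fin 3) : trianglePerimeter T • triangleIncenter T =
    edgeLength T i • T.points i + edgeLength T (i + 1) • T.points (i + 1) +
      edgeLength T (i + 2) • T.points (i + 2) := by
  rw [triangleIncenter, smul_inv_smul₀ (trianglePerimeter_pos T).ne', Fin.sum_univ_three]
  fin_cases i
  · rfl
  · show _ = edgeLength T 1 • T.points 1 + edgeLength T 2 • T.points 2 +
      edgeLength T 0 • T.points 0
    abel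
  · show _ = edgeLength T 2 • T.points 2 + edgeLength T 0 • T.points 0 +
      edgeLength T 1 • T.points 1
    abel

/-- Pythagoras for the vertex, the incenter and a point of tangency, verified from the weighted-mean
formula for the incenter. -/
lemma nsq_incenter_sub (i : Fin 3) :
    nsq (triangleIncenter T - T.points i) = inradius T ^ 2 + tangentLength T i ^ 2 := by
  obtain ⟨e1, e2, e3, e4⟩ := fin3_add i
  have hP := trianglePerimeter_pos T
  have hc := triangleIncenter_eq T i
  have hp := trianglePerimeter_eq T i
  have hd := dotp_edges T i
  have hs1 := edgeLength_sq T (i + 1)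
  have hs2 := edgeLength_sq T (i + 2)
  rw [e1, e2] at hs1
  rw [e3, e4] at hs2
  have c0 := congrArg (fun v : Plane => v 0) hc
  have c1 := congrArg (fun v : Plane => v 1) hc
  simp only [PiLp.smul_apply, PiLp.add_apply, smul_eq_mul] at c0 c1
  simp only [nsq, dotp, PiLp.sub_apply] at hd hs1 hs2 ⊢
  have g0 : trianglePerimeter T * (triangleIncenter T 0 - T.points i 0) =
      edgeLength T (i + 1) * (T.points (i + 1) 0 - T.points i 0) +
      edgeLength T (i + 2) * (T.points (i + 2) 0 - T.points i 0) := by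
    rw [mul_sub, c0, hp]; ring
  have g1 : trianglePerimeter T * (triangleIncenter T 1 - T.points i 1) =
      edgeLength T (i + 1) * (T.points (i + 1) 1 - T.points i 1) +
      edgeLength T (i + 2) * (T.points (i + 2) 1 - T.points i 1) := by
    rw [mul_sub, c1, hp]; ring
  have hr := inradius_sq_mul T i
  have key : trianglePerimeter T ^ 2 * ((triangleIncenter T 0 - T.points i 0) ^ 2 +
      (triangleIncenter T 1 - T.points i 1) ^ 2) =
      trianglePerimeter T ^ 2 * (inradius T ^ 2 + tangentLength T i ^ 2) := by
    have l : trianglePerimeter T ^ 2 * ((triangleIncenter T 0 - T.points i 0) ^ 2 +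
      (triangleIncenter T 1 - T.points i 1) ^ 2) =
      (trianglePerimeter T * (triangleIncenter T 0 - T.points i 0)) ^ 2 +
      (trianglePerimeter T * (triangleIncenter T 1 - T.points i 1)) ^ 2 := by ring
    have l2 : trianglePerimeter T ^ 2 * (inradius T ^ 2 + tangentLength T i ^ 2) =
        2 * trianglePerimeter T * (inradius T ^ 2 * (trianglePerimeter T / 2)) +
        trianglePerimeter T ^ 2 * tangentLength T i ^ 2 := by ring
    rw [l, g0, g1, l2, hr, hp]
    simp only [tangentLength, e1, e2, e3, e4]
    linear_combination (-edgeLength T (i + 1) ^ 2) * hs2 - edgeLength T (i + 2) ^ 2 * hs1 +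
      2 * edgeLength T (i + 1) * edgeLength T (i + 2) * hd
  exact mul_left_cancel₀ (by positivity) key

lemma cross_incenter (i : Fin 3) :
    cross (T.points (i + 1) - triangleIncenter T) (T.points (i + 2) - triangleIncenter T) =
      edgeLength T i * (signedArea2 T / trianglePerimeter T) := by
  have hP := trianglePerimeter_pos T
  have hc := triangleIncenter_eq T i
  have hp := trianglePerimeter_eq T i
  have c0 := congrArg (fun v : Plane => v 0) hc
  have c1 := congrArg (fun v : Plane => v 1) hc
  simp only [PiLp.smul_apply, PiLp.add_apply, smul_eq_mul] at c0 c1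
  have key : trianglePerimeter T * cross (T.points (i + 1) - triangleIncenter T)
      (T.points (i + 2) - triangleIncenter T) = edgeLength T i * signedArea2 T := by
    rw [← cross_points T i]
    simp only [cross, PiLp.sub_apply]
    linear_combination (T.points (i + 1) 1 - T.points (i + 2) 1) * c0 +
      (T.points (i + 2) 0 - T.points (i + 1) 0) * c1 +
      (T.points (i + 1) 0 * T.points (i + 2) 1 - T.points (i + 1) 1 * T.points (i + 2) 0) * hp
  rw [← mul_div_assoc, eq_div_iff hP.ne', mul_comm, key]

lemma abs_cross_incenter (i : Fin 3) :
    |cross (T.points (i + 1) - triangleIncenter T) (T.points (i + 2) - triangleIncenter T)| =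
      inradius T * edgeLength T i := by
  rw [cross_incenter, abs_mul, abs_div, abs_of_pos (edgeLength_pos T i),
    abs_of_pos (trianglePerimeter_pos T), inradius, mul_comm]

lemma cross_incenter_ne_zero (i : Fin 3) :
    cross (T.points (i + 1) - triangleIncenter T) (T.points (i + 2) - triangleIncenter T) ≠ 0 := by
  rw [← abs_pos, abs_cross_incenter]
  exact mul_pos (inradius_pos T) (edgeLength_pos T i)

lemma triangleSet_eq (i : Fin 3) :
    triangleSet T = convexHull ℝ {T.points i, T.points (i + 1), T.points (i + 2)} := by
  rw [triangleSet]
  congr 1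
  ext x
  simp only [Set.mem_range, Set.mem_insert_iff, Set.mem_singleton_iff]
  constructor
  · rintro ⟨j, rfl⟩
    have : j = i ∨ j = i + 1 ∨ j = i + 2 := by revert i j; decide
    rcases this with rfl | rfl | rfl <;> simp
  · rintro (rfl | rfl | rfl) <;> exact ⟨_, rfl⟩

lemma triangleArea_eq : triangleArea T = |signedArea2 T| / 2 := by
  have h := cross_points T 0
  have h0 : cross (T.points (0 + 1) - T.points 0) (T.points (0 + 2) - T.points 0) ≠ 0 := by
    rw [h]; exact signedArea2_ne_zero T
  rw [triangleArea, triangleSet_eq T 0, volume_convexHull_triple h0, h,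
    ENNReal.toReal_ofReal (by positivity)]

lemma aspectRatio_eq : aspectRatio T = longestEdge T / (2 * inradius T) := by
  rw [aspectRatio, incircleDiameter, triangleArea_eq, inradius]
  congr 1
  ring

lemma edgeLength_le_longestEdge (i : Fin 3) : edgeLength T i ≤ longestEdge T :=
  le_ciSup (Set.finite_range _).bddAbove i

/-- The large angle condition bounds the inradius by the tangent lengths. -/
lemma inradius_le_of_largeAngleCondition {δ : ℝ} (hδ : 0 < δ) (h : LargeAngleCondition δ T)
    (i : Fin 3) : inradius T ≤ √(2 / (1 - Real.cos δ)) * tangentLength T i := by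
  obtain ⟨e1, e2, e3, e4⟩ := fin3_add i
  have hα := h i
  have hα0 : 0 ≤ triangleAngle T i := InnerProductGeometry.angle_nonneg _ _
  have hδπ : δ < Real.pi := by linarith
  have hcos := Real.cos_lt_cos_of_nonneg_of_le_pi hα0 (by linarith) hα
  rw [Real.cos_pi_sub] at hcos
  have hc : 0 < 1 - Real.cos δ := by
    have := Real.cos_lt_cos_of_nonneg_of_le_pi le_rfl hδπ.le hδ
    rw [Real.cos_zero] at this
    linarith
  have h1 := edgeLength_pos T (i + 1)
  have h2 := edgeLength_pos T (i + 2)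
  have hS : 0 < trianglePerimeter T / 2 := by linarith [trianglePerimeter_pos T]
  have ht := tangentLength_pos T i
  have hcosα : Real.cos (triangleAngle T i) * (edgeLength T (i + 1) * edgeLength T (i + 2)) =
      (edgeLength T (i + 1) ^ 2 + edgeLength T (i + 2) ^ 2 - edgeLength T i ^ 2) / 2 := by
    have := InnerProductGeometry.cos_angle_mul_norm_mul_norm (T.points (i + 1) - T.points i)
      (T.points (i + 2) - T.points i)
    rw [← dist_eq_norm, ← dist_eq_norm, dist_comm] at this
    rw [← dotp_edges, triangleAngle, EuclideanGeometry.angle]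
    simp only [edgeLength, e1, e2, e3, e4]
    rw [mul_comm (dist (T.points (i + 2)) _), vsub_eq_sub, vsub_eq_sub, this, PiLp.inner_apply,
      Fin.sum_univ_two, dotp]
    simp [mul_comm]
  have hdS : (inradius T ^ 2 + tangentLength T i ^ 2) * (trianglePerimeter T / 2) =
      edgeLength T (i + 1) * edgeLength T (i + 2) * tangentLength T i := by
    rw [add_mul, inradius_sq_mul T i, edgeLength_eq T (i + 1), edgeLength_eq T (i + 2),
      semiperimeter_eq T i, e1, e2, e3, e4]
    ring
  -- Together with `hdS` this is `cos² (αᵢ/2) = tᵢ² / (r² + tᵢ²)`. The resulting constant `√(2 / (1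
  -- - cos δ))` equals `1 / sin (δ/2)`, slightly larger than the optimal `cot (δ/2)`.
  have h3 : (1 + Real.cos (triangleAngle T i)) *
      (edgeLength T (i + 1) * edgeLength T (i + 2)) =
      2 * (trianglePerimeter T / 2) * tangentLength T i := by
    rw [add_mul, hcosα, trianglePerimeter_eq T i, tangentLength]; ring
  have h4 : (1 - Real.cos δ) * (inradius T ^ 2 + tangentLength T i ^ 2) ≤
      2 * tangentLength T i ^ 2 := by
    have h5 : (1 - Real.cos δ) * (edgeLength T (i + 1) * edgeLength T (i + 2)) ≤
        2 * (trianglePerimeter T / 2) * tangentLength T i := by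
      rw [← h3]
      exact mul_le_mul_of_nonneg_right (by linarith) (by positivity)
    have h6 := mul_le_mul_of_nonneg_right h5 ht.le
    have h7 : ((1 - Real.cos δ) * (inradius T ^ 2 + tangentLength T i ^ 2)) *
        (trianglePerimeter T / 2) ≤ (2 * tangentLength T i ^ 2) * (trianglePerimeter T / 2) := by
      rw [mul_assoc, hdS]; linarith
    exact le_of_mul_le_mul_right h7 hS
  have h8 : inradius T ^ 2 ≤ 2 / (1 - Real.cos δ) * tangentLength T i ^ 2 := by
    rw [div_mul_eq_mul_div, le_div_iff₀ hc]
    nlinarith [mul_nonneg hc.le (sq_nonneg (tangentLength T i))]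
  have h9 : inradius T ^ 2 ≤ (√(2 / (1 - Real.cos δ)) * tangentLength T i) ^ 2 := by
    rw [mul_pow, Real.sq_sqrt (by positivity)]; exact h8
  exact le_of_sq_le_sq h9 (by positivity)

/-! ### Barycentric coordinates and the split triangles -/

/-- The barycentric coordinates. -/
noncomputable def bary (i : Fin 3) (x : Plane) : ℝ :=
  cross (T.points (i + 1) - x) (T.points (i + 2) - x) / signedArea2 T

/-- The gradient of a barycentric coordinate. -/
noncomputable def baryGrad (i : Fin 3) : Plane :=
  !₂[(T.points (i + 1) 1 - T.points (i + 2) 1) / signedArea2 T,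
    (T.points (i + 2) 0 - T.points (i + 1) 0) / signedArea2 T]

lemma bary_sub (i : Fin 3) (x y : Plane) :
    dotp (baryGrad T i) (x - y) = bary T i x - bary T i y := by
  simp [bary, baryGrad, dotp, cross]; ring

lemma continuous_bary (i : Fin 3) : Continuous (bary T i) := by
  unfold bary cross; fun_prop

lemma bary_self (i : Fin 3) : bary T i (T.points i) = 1 := by
  rw [bary, cross_points, div_self (signedArea2_ne_zero T)]

lemma bary_add_one (i : Fin 3) : bary T (i + 1) (T.points i) = 0 := by
  obtain ⟨e1, e2, e3, e4⟩ := fin3_add i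
  simp [bary, cross, e2]

lemma bary_add_two (i : Fin 3) : bary T (i + 2) (T.points i) = 0 := by
  obtain ⟨e1, e2, e3, e4⟩ := fin3_add i
  simp [bary, cross, e3]

lemma bary_sum (i : Fin 3) (x : Plane) :
    bary T i x + bary T (i + 1) x + bary T (i + 2) x = 1 := by
  obtain ⟨e1, e2, e3, e4⟩ := fin3_add i
  have hD := signedArea2_ne_zero T
  simp only [bary, e1, e2, e3, e4]
  rw [← add_div, ← add_div, div_eq_one_iff_eq hD, ← cross_points T i]
  simp only [cross, PiLp.sub_apply]; ring

lemma bary_combination (i : Fin 3) (x : Plane) :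
    x = bary T i x • T.points i + bary T (i + 1) x • T.points (i + 1) +
      bary T (i + 2) x • T.points (i + 2) := by
  obtain ⟨e1, e2, e3, e4⟩ := fin3_add i
  have hD := signedArea2_ne_zero T
  have h : signedArea2 T • x = signedArea2 T • (bary T i x • T.points i +
      bary T (i + 1) x • T.points (i + 1) + bary T (i + 2) x • T.points (i + 2)) := by
    simp only [smul_add, smul_smul, bary, e1, e2, e3, e4, mul_div_cancel₀ _ hD]
    rw [← cross_points T i]
    ext k
    fin_cases k <;> simp [cross] <;> ring
  exact smul_right_injective _ hD h

lemma bary_add_smul (i : Fin 3) (x y : Plane) (s : ℝ) :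
    bary T i (x + s • (y - x)) = (1 - s) * bary T i x + s * bary T i y := by
  have h1 := bary_sub T i (x + s • (y - x)) x
  have h2 := bary_sub T i y x
  rw [add_sub_cancel_left, dotp_smul_right, h2] at h1
  linarith

lemma bary_incenter (i : Fin 3) :
    bary T i (triangleIncenter T) = edgeLength T i / trianglePerimeter T := by
  have hD := signedArea2_ne_zero T
  rw [bary, cross_incenter]
  field_simp

/-- The barycentric coordinates, scaled so that they agree at the incenter. -/
noncomputable def scaledBary (i : Fin 3) (x : Plane) : ℝ := bary T i x / edgeLength T i

lemma continuous_scaledBary (i : Fin 3) : Continuous (scaledBary T i) :=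
  (continuous_bary T i).div_const _

lemma mem_convexHull_triple {p q s x : Plane} :
    x ∈ convexHull ℝ {p, q, s} ↔ ∃ a b : ℝ, 0 ≤ a ∧ 0 ≤ b ∧ a + b ≤ 1 ∧
      x = p + a • (q - p) + b • (s - p) := by
  rw [convexHull_triple]
  simp only [Set.mem_image, exists_exists_and_eq_and, columnMap_apply, prodPlane_apply]
  constructor
  · rintro ⟨⟨a, b⟩, ⟨h1, h2, h3⟩, rfl⟩
    exact ⟨a, b, h1, h2, h3, by simp [add_assoc]⟩
  · rintro ⟨a, b, h1, h2, h3, rfl⟩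
    exact ⟨(a, b), ⟨h1, h2, h3⟩, by simp [add_assoc]⟩

/-- The `i`-th triangle of the Clough–Tocher split at the incenter. -/
def splitTriangle (i : Fin 3) : Set Plane :=
  convexHull ℝ {triangleIncenter T, T.points (i + 1), T.points (i + 2)}

/-- Up to a common factor `scaledBary T i` is the signed distance to the line of `eᵢ`, so `Kᵢ`
collects the points nearest to `eᵢ`. Removing the smallest value from all three scaled coordinates
splits off a multiple of the incenter and leaves nonnegative weights on the endpoints of `eᵢ`. -/
lemma mem_splitTriangle {i : Fin 3} {x : Plane} (h0 : 0 ≤ scaledBary T i x)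
    (h1 : scaledBary T i x ≤ scaledBary T (i + 1) x)
    (h2 : scaledBary T i x ≤ scaledBary T (i + 2) x) : x ∈ splitTriangle T i := by
  have hP := trianglePerimeter_pos T
  have e0 := edgeLength_pos T i
  have e1 := edgeLength_pos T (i + 1)
  have e2 := edgeLength_pos T (i + 2)
  have b : ∀ j, bary T j x = edgeLength T j * scaledBary T j x := by
    intro j
    have := edgeLength_pos T j
    rw [scaledBary]; field_simp
  have hs := bary_sum T i x
  have hx := bary_combination T i x
  have hc := triangleIncenter_eq T i
  have hp := trianglePerimeter_eq T i
  rw [b, b, b] at hs hx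
  refine mem_convexHull_triple.2 ⟨edgeLength T (i + 1) * (scaledBary T (i + 1) x -
    scaledBary T i x), edgeLength T (i + 2) * (scaledBary T (i + 2) x - scaledBary T i x),
    mul_nonneg e1.le (by linarith), mul_nonneg e2.le (by linarith), ?_, ?_⟩
  · have : 0 ≤ trianglePerimeter T * scaledBary T i x := by positivity
    rw [hp] at this
    linarith
  · have hcoef : trianglePerimeter T * scaledBary T i x = 1 - edgeLength T (i + 1) *
        (scaledBary T (i + 1) x - scaledBary T i x) -
        edgeLength T (i + 2) * (scaledBary T (i + 2) x - scaledBary T i x) := by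
      rw [hp]; linarith
    have h3 : scaledBary T i x • (edgeLength T i • T.points i + edgeLength T (i + 1) •
        T.points (i + 1) + edgeLength T (i + 2) • T.points (i + 2)) =
        (1 - edgeLength T (i + 1) * (scaledBary T (i + 1) x - scaledBary T i x) -
        edgeLength T (i + 2) * (scaledBary T (i + 2) x - scaledBary T i x)) •
        triangleIncenter T := by
      rw [← hc, ← hcoef, smul_smul, mul_comm]
    have h4 : triangleIncenter T + (edgeLength T (i + 1) * (scaledBary T (i + 1) x -
        scaledBary T i x)) • (T.points (i + 1) - triangleIncenter T) +
        (edgeLength T (i + 2) * (scaledBary T (i + 2) x - scaledBary T i x)) •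
        (T.points (i + 2) - triangleIncenter T) =
        (1 - edgeLength T (i + 1) * (scaledBary T (i + 1) x - scaledBary T i x) -
        edgeLength T (i + 2) * (scaledBary T (i + 2) x - scaledBary T i x)) •
        triangleIncenter T + (edgeLength T (i + 1) * (scaledBary T (i + 1) x -
        scaledBary T i x)) • T.points (i + 1) +
        (edgeLength T (i + 2) * (scaledBary T (i + 2) x - scaledBary T i x)) •
        T.points (i + 2) := by module
    rw [h4, ← h3]
    refine hx.trans ?_
    module

lemma mem_triangleSet_iff {x : Plane} : x ∈ triangleSet T ↔ ∀ i, 0 ≤ bary T i x := by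
  have key : ∀ i, x ∈ triangleSet T → 0 ≤ bary T i x := by
    intro i hx
    rw [triangleSet_eq T i, mem_convexHull_triple] at hx
    obtain ⟨a, b, ha, hb, hab, rfl⟩ := hx
    have h1 := bary_sub T i (T.points i + a • (T.points (i + 1) - T.points i) +
      b • (T.points (i + 2) - T.points i)) (T.points i)
    have h2 := bary_sub T i (T.points (i + 1)) (T.points i)
    have h3 := bary_sub T i (T.points (i + 2)) (T.points i)
    have z1 : bary T i (T.points (i + 1)) = 0 := by simp [bary, cross]
    have z2 : bary T i (T.points (i + 2)) = 0 := by simp [bary, cross]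
    rw [add_assoc, add_sub_cancel_left, dotp_add_right, dotp_smul_right, dotp_smul_right, h2, h3,
      z1, z2, bary_self, ← add_assoc] at h1
    linarith
  refine ⟨fun hx i => key i hx, fun h => ?_⟩
  rw [triangleSet_eq T 0, mem_convexHull_triple]
  have hs := bary_sum T 0 x
  refine ⟨bary T (0 + 1) x, bary T (0 + 2) x, h _, h _, by linarith [h 0], ?_⟩
  refine (bary_combination T 0 x).trans ?_
  have : bary T 0 x = 1 - bary T (0 + 1) x - bary T (0 + 2) x := by linarith
  rw [this]
  module

lemma incenter_mem_triangleSet : triangleIncenter T ∈ triangleSet T := by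
  rw [mem_triangleSet_iff]
  intro i
  rw [bary_incenter]
  exact div_nonneg (edgeLength_nonneg T i) (trianglePerimeter_pos T).le

lemma convex_triangleSet : Convex ℝ (triangleSet T) := convex_convexHull _ _

lemma splitTriangle_subset (i : Fin 3) : splitTriangle T i ⊆ triangleSet T := by
  refine convexHull_min ?_ (convex_triangleSet T)
  intro x hx
  simp only [Set.mem_insert_iff, Set.mem_singleton_iff] at hx
  rcases hx with rfl | rfl | rfl
  · exact incenter_mem_triangleSet T
  · exact subset_convexHull _ _ ⟨_, rfl⟩
  · exact subset_convexHull _ _ ⟨_, rfl⟩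

lemma triangleSet_eq_iUnion : triangleSet T = ⋃ i, splitTriangle T i := by
  refine Set.Subset.antisymm ?_ (Set.iUnion_subset (splitTriangle_subset T))
  intro x hx
  rw [mem_triangleSet_iff] at hx
  have h0 : ∀ i, 0 ≤ scaledBary T i x := fun i => div_nonneg (hx i) (edgeLength_nonneg T i)
  obtain ⟨i, -, hi⟩ := Finset.exists_min_image Finset.univ (fun i => scaledBary T i x)
    Finset.univ_nonempty
  exact Set.mem_iUnion.2 ⟨i, mem_splitTriangle T (h0 i) (hi _ (Finset.mem_univ _))
    (hi _ (Finset.mem_univ _))⟩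

lemma isClosed_splitTriangle (i : Fin 3) : IsClosed (splitTriangle T i) :=
  Set.Finite.isClosed_convexHull ℝ (Set.toFinite _)

lemma meshDomain_cloughTocher :
    meshDomain (cloughTocher T (triangleIncenter T)) = interior (triangleSet T) := by
  rw [meshDomain, cloughTocher, Set.biUnion_range, triangleSet_eq_iUnion]
  congr 1
  exact Set.iUnion_congr fun i => (isClosed_splitTriangle T i).closure_eq

end Geometry

/-! ### Continuous piecewise quadratics on the split triangle -/

lemma convex_splitTriangle (T : Affine.Triangle ℝ Plane) (i : Fin 3) :
    Convex ℝ (splitTriangle T i) := convex_convexHull _ _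

lemma ae_mem_interior_splitTriangle (T : Affine.Triangle ℝ Plane) (i : Fin 3) :
    ∀ᵐ x : Plane, x ∈ splitTriangle T i → x ∈ interior (splitTriangle T i) := by
  have h := (convex_splitTriangle T i).addHaar_frontier volume
  filter_upwards [measure_eq_zero_iff_ae_notMem.1 h] with x hx hxi
  rw [frontier, (isClosed_splitTriangle T i).closure_eq] at hx
  by_contra hc
  exact hx ⟨hxi, hc⟩

/-- The weak gradient of a function that is piecewise quadratic is its piecewise gradient. -/
lemma weak_gradient_ae_eq_quadGrad {T : Affine.Triangle ℝ Plane} {u : Plane → ℝ}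
    {g : Plane → Plane} (hg : HasWeakGradient (interior (triangleSet T)) u g) {i : Fin 3}
    {a : Fin 6 → ℝ} (ha : ∀ᵐ x : Plane, x ∈ splitTriangle T i → u x = quad a x) :
    ∀ᵐ x : Plane, x ∈ splitTriangle T i → g x = quadGrad a x := by
  have h := weak_gradient_ae_eq_gradient (isOpen_interior (s := splitTriangle T i))
    (interior_mono (splitTriangle_subset T i)) hg (contDiff_quad a)
    (ha.mono fun x hx hxi => hx (interior_subset hxi))
  filter_upwards [h, ae_mem_interior_splitTriangle T i] with x hx hxi hxK
  rw [hx (hxi hxK), gradient_quad]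

/-- Near an interior point of a spoke or of an edge, the zero extension consists of just two smooth
pieces, so the jump lemma applies. At endpoints more pieces may meet, which is why only open
segments appear; polynomial identity recovers the endpoints later. -/
lemma exists_quad_of_mem_conformingPolyZero (T : Affine.Triangle ℝ Plane) {u : Plane → ℝ}
    (hu : u ∈ conformingPolyZero 2 (cloughTocher T (triangleIncenter T))) :
    ∃ a : Fin 3 → Fin 6 → ℝ,
      (∀ i, ∀ᵐ x : Plane, x ∈ splitTriangle T i → u x = quad (a i) x) ∧
      (∀ (j : Fin 3) (s : ℝ), 0 < s → s < 1 →
        quad (a (j + 1)) (T.points j + s • (triangleIncenter T - T.points j)) =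
          quad (a (j + 2)) (T.points j + s • (triangleIncenter T - T.points j))) ∧
      (∀ (i : Fin 3) (s : ℝ), 0 < s → s < 1 →
        quad (a i) (T.points (i + 1) + s • (T.points (i + 2) - T.points (i + 1))) = 0) := by
  obtain ⟨⟨⟨-, hpoly⟩, -⟩, h10⟩ := hu
  rw [meshDomain_cloughTocher] at h10
  obtain ⟨g, hg, hweak⟩ := exists_weak_gradient_of_mem_sobolevH10 isOpen_interior.measurableSet h10
  have hex : ∀ i, ∃ a : Fin 6 → ℝ, ∀ᵐ x : Plane, x ∈ splitTriangle T i → u x = quad a x := by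
    intro i
    obtain ⟨p, hp, hup⟩ := hpoly (splitTriangle T i) ⟨i, rfl⟩
    obtain ⟨a, ha⟩ := exists_quad_of_totalDegree_le_two p hp
    rw [ae_restrict_iff' (isClosed_splitTriangle T i).measurableSet] at hup
    exact ⟨a, hup.mono fun x hx hxi => (hx hxi).trans (ha x)⟩
  choose a ha using hex
  refine ⟨a, ha, ?_, ?_⟩
  all_goals
    set D := interior (triangleSet T)
    have hin : ∀ i, ∀ᵐ x : Plane, x ∈ splitTriangle T i → D.indicator u x = quad (a i) x ∧
        D.indicator g x = gradient (quad (a i)) x := by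
      intro i
      filter_upwards [ha i, weak_gradient_ae_eq_quadGrad hg (ha i),
        ae_mem_interior_splitTriangle T i] with x h1 h2 h3 hx
      have hxD : x ∈ D := interior_mono (splitTriangle_subset T i) (h3 hx)
      rw [Set.indicator_of_mem hxD, Set.indicator_of_mem hxD, gradient_quad]
      exact ⟨h1 hx, h2 hx⟩
    -- The exterior counts as one more quadratic piece, so a boundary edge is treated like a spoke.
    have hout : ∀ x, x ∉ triangleSet T → D.indicator u x = quad 0 x ∧
        D.indicator g x = gradient (quad 0) x := by
      intro x hx
      have hxD : x ∉ D := fun h => hx (interior_subset h)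
      rw [Set.indicator_of_notMem hxD, Set.indicator_of_notMem hxD, gradient_quad, quad_zero]
      refine ⟨rfl, ?_⟩
      ext k; fin_cases k <;> simp [quadGrad]
    have hP := trianglePerimeter_pos T
  · intro j s hs0 hs1
    set x0 := T.points j + s • (triangleIncenter T - T.points j) with hx0
    obtain ⟨e1, e2, e3, e4⟩ := fin3_add j
    have hj := edgeLength_pos T j
    have hj1 := edgeLength_pos T (j + 1)
    have hj2 := edgeLength_pos T (j + 2)
    have v0 : scaledBary T j x0 = (1 - s) / edgeLength T j + s / trianglePerimeter T := by
      rw [scaledBary, hx0, bary_add_smul, bary_self, bary_incenter]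
      field_simp
    have v1 : scaledBary T (j + 1) x0 = s / trianglePerimeter T := by
      rw [scaledBary, hx0, bary_add_smul, bary_add_one, bary_incenter]
      field_simp
      ring
    have v2 : scaledBary T (j + 2) x0 = s / trianglePerimeter T := by
      rw [scaledBary, hx0, bary_add_smul, bary_add_two, bary_incenter]
      field_simp
      ring
    -- Normal to the spoke from `zⱼ`: the gradient of the difference of two scaled coordinates that
    -- agree along it. Its positive side lies in `K (j + 1)`, its negative side in `K (j + 2)`,
    -- locally.
    set m : Plane := (edgeLength T (j + 2))⁻¹ • baryGrad T (j + 2) -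
      (edgeLength T (j + 1))⁻¹ • baryGrad T (j + 1) with hm_def
    have hm : ∀ x y, dotp m (x - y) = (scaledBary T (j + 2) x - scaledBary T (j + 1) x) -
        (scaledBary T (j + 2) y - scaledBary T (j + 1) y) := by
      intro x y
      have h1 := bary_sub T (j + 1) x y
      have h2 := bary_sub T (j + 2) x y
      have : dotp m (x - y) = (edgeLength T (j + 2))⁻¹ * dotp (baryGrad T (j + 2)) (x - y) -
          (edgeLength T (j + 1))⁻¹ * dotp (baryGrad T (j + 1)) (x - y) := by
        simp [hm_def, dotp]; ring
      rw [this, h1, h2, scaledBary, scaledBary, scaledBary, scaledBary]; ring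
    have hm0 : m ≠ 0 := by
      intro h0
      have h1 := hm (T.points (j + 2)) (T.points j)
      have z1 : bary T (j + 1) (T.points (j + 2)) = 0 := by
        have := bary_add_two T (j + 2); rwa [e4] at this
      rw [h0, scaledBary, scaledBary, scaledBary, scaledBary, bary_self, z1, bary_add_one,
        bary_add_two] at h1
      simp [dotp] at h1
      exact hj2.ne h1
    have hU : {x | 0 < scaledBary T (j + 1) x ∧ 0 < scaledBary T (j + 2) x ∧
        scaledBary T (j + 1) x < scaledBary T j x ∧
        scaledBary T (j + 2) x < scaledBary T j x} ∈ 𝓝 x0 := by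
      have c0 := (continuous_scaledBary T j).continuousAt (x := x0)
      have c1 := (continuous_scaledBary T (j + 1)).continuousAt (x := x0)
      have c2 := (continuous_scaledBary T (j + 2)).continuousAt (x := x0)
      have hpos : 0 < s / trianglePerimeter T := by positivity
      have hpos2 : 0 < (1 - s) / edgeLength T j := div_pos (by linarith) hj
      filter_upwards [c1.eventually_const_lt (by rw [v1]; exact hpos),
        c2.eventually_const_lt (by rw [v2]; exact hpos),
        c1.eventually_lt c0 (by rw [v0, v1]; linarith),
        c2.eventually_lt c0 (by rw [v0, v2]; linarith)] with x h1 h2 h3 h4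
      exact ⟨h1, h2, h3, h4⟩
    refine eq_of_weak_gradient_across_line hm0 hU (contDiff_quad _) (contDiff_quad _) ?_ ?_ hweak
    · filter_upwards [hin (j + 1)] with x hx hxU hpos
      rw [hm, v1, v2] at hpos
      refine hx (mem_splitTriangle T hxU.1.le ?_ ?_)
      · rw [e1]; linarith
      · rw [e2]; exact hxU.2.2.1.le
    · filter_upwards [hin (j + 2)] with x hx hxU hneg
      rw [hm, v1, v2] at hneg
      refine hx (mem_splitTriangle T hxU.2.1.le ?_ ?_)
      · rw [e3]; exact hxU.2.2.2.le
      · rw [e4]; linarith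
  · intro i s hs0 hs1
    set x0 := T.points (i + 1) + s • (T.points (i + 2) - T.points (i + 1)) with hx0
    obtain ⟨e1, e2, e3, e4⟩ := fin3_add i
    have hj := edgeLength_pos T i
    have hj1 := edgeLength_pos T (i + 1)
    have hj2 := edgeLength_pos T (i + 2)
    have z1 : bary T i (T.points (i + 1)) = 0 := by
      have := bary_add_two T (i + 1); rwa [e2] at this
    have z2 : bary T i (T.points (i + 2)) = 0 := by
      have := bary_add_one T (i + 2); rwa [e3] at this
    have z3 : bary T (i + 1) (T.points (i + 2)) = 0 := by
      have := bary_add_two T (i + 2); rwa [e4] at this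
    have z4 : bary T (i + 2) (T.points (i + 1)) = 0 := by
      have := bary_add_one T (i + 1); rwa [e1] at this
    have v0 : bary T i x0 = 0 := by rw [hx0, bary_add_smul, z1, z2]; ring
    have v1 : scaledBary T (i + 1) x0 = (1 - s) / edgeLength T (i + 1) := by
      rw [scaledBary, hx0, bary_add_smul, bary_self, z3]; ring
    have v2 : scaledBary T (i + 2) x0 = s / edgeLength T (i + 2) := by
      rw [scaledBary, hx0, bary_add_smul, bary_self, z4]; ring
    have hm : ∀ x, dotp (baryGrad T i) (x - x0) = bary T i x := by
      intro x
      rw [bary_sub, v0, sub_zero]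
    have hm0 : baryGrad T i ≠ 0 := by
      intro h0
      have := hm (T.points i)
      rw [h0, bary_self] at this
      simp [dotp] at this
    have hU : {x | scaledBary T i x < scaledBary T (i + 1) x ∧
        scaledBary T i x < scaledBary T (i + 2) x} ∈ 𝓝 x0 := by
      have c0 := (continuous_scaledBary T i).continuousAt (x := x0)
      have c1 := (continuous_scaledBary T (i + 1)).continuousAt (x := x0)
      have c2 := (continuous_scaledBary T (i + 2)).continuousAt (x := x0)
      have v0' : scaledBary T i x0 = 0 := by rw [scaledBary, v0, zero_div]
      filter_upwards [c0.eventually_lt c1 (by rw [v0', v1]; exact div_pos (by linarith) hj1),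
        c0.eventually_lt c2 (by rw [v0', v2]; exact div_pos hs0 hj2)] with x h1 h2
      exact ⟨h1, h2⟩
    have := eq_of_weak_gradient_across_line hm0 hU (contDiff_quad (a i)) (contDiff_quad 0) ?_ ?_
      hweak
    · rw [this, quad_zero]
    · filter_upwards [hin i] with x hx hxU hpos
      rw [hm] at hpos
      exact hx (mem_splitTriangle T (div_nonneg hpos.le hj.le) hxU.1.le hxU.2.le)
    · refine ae_of_all _ fun x _ hneg => hout x fun hxT => ?_
      rw [hm] at hneg
      exact absurd ((mem_triangleSet_iff T).1 hxT i) (not_le.2 hneg)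

/-! ### The estimate -/

lemma one_le_coreConst {K : ℝ} (hK : 0 ≤ K) : 1 ≤ coreConst K := by
  unfold coreConst
  have h1 : 1 ≤ 1 + K ^ 2 := by nlinarith
  have h2 : 1 / 2 ≤ 1 / 2 + 2 * K * (1 + K ^ 2) := by
    have : 0 ≤ 2 * K * (1 + K ^ 2) := by positivity
    linarith
  have h3 : 12 ≤ 24 * (1 + K ^ 2) * (1 / 2 + 2 * K * (1 + K ^ 2)) := by nlinarith
  nlinarith

lemma nsq_convexCombination_le {p q s : Plane} {a b : ℝ} (ha : 0 ≤ a) (hb : 0 ≤ b)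
    (hab : a + b ≤ 1) :
    nsq (p + a • (q - p) + b • (s - p)) ≤ nsq p + nsq q + nsq s := by
  have key : ∀ x y z : ℝ, (x + a * (y - x) + b * (z - x)) ^ 2 ≤ x ^ 2 + y ^ 2 + z ^ 2 := by
    intro x y z
    have h1 : (x + a * (y - x) + b * (z - x)) ^ 2 =
        (1 - a - b) * x ^ 2 + a * y ^ 2 + b * z ^ 2 - (1 - a - b) * a * (x - y) ^ 2 -
        (1 - a - b) * b * (x - z) ^ 2 - a * b * (y - z) ^ 2 := by ring
    have hc : 0 ≤ 1 - a - b := by linarith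
    have := mul_nonneg (mul_nonneg hc ha) (sq_nonneg (x - y))
    have := mul_nonneg (mul_nonneg hc hb) (sq_nonneg (x - z))
    have := mul_nonneg (mul_nonneg ha hb) (sq_nonneg (y - z))
    have := mul_nonneg (by linarith : 0 ≤ a + b) (sq_nonneg x)
    have := mul_nonneg (by linarith : 0 ≤ 1 - a) (sq_nonneg y)
    have := mul_nonneg (by linarith : 0 ≤ 1 - b) (sq_nonneg z)
    linarith
  have h0 := key (p 0) (q 0) (s 0)
  have h1 := key (p 1) (q 1) (s 1)
  simp only [nsq, PiLp.add_apply, PiLp.smul_apply, PiLp.sub_apply, smul_eq_mul]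
  linarith

/-- The estimate for the squared norms of piecewise gradients. -/
theorem lintegral_rowNsq_le (T : Affine.Triangle ℝ Plane) {K : ℝ} (hK0 : 0 ≤ K)
    (hK : ∀ i, inradius T ≤ K * tangentLength T i) (a : Fin 2 → Fin 3 → Fin 6 → ℝ)
    (hint : ∀ c (j : Fin 3) (s : ℝ), 0 < s → s < 1 →
        quad (a c (j + 1)) (T.points j + s • (triangleIncenter T - T.points j)) =
          quad (a c (j + 2)) (T.points j + s • (triangleIncenter T - T.points j)))
    (hbd : ∀ c (i : Fin 3) (s : ℝ), 0 < s → s < 1 →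
        quad (a c i) (T.points (i + 1) + s • (T.points (i + 2) - T.points (i + 1))) = 0)
    {I : ℝ} (hI0 : 0 ≤ I)
    (hI : ∀ i, ∫⁻ x in splitTriangle T i,
      ENNReal.ofReal (rowTrace (fun c => quadGrad (a c i) x) ^ 2) ≤ ENNReal.ofReal I) (i : Fin 3) :
    ∫⁻ x in splitTriangle T i, ENNReal.ofReal (rowNsq fun c => quadGrad (a c i) x) ≤
      ENNReal.ofReal (144 * coreConst K * aspectRatio T ^ 2 * I) := by
  have hr := inradius_pos T
  set o := triangleIncenter T with ho
  set z := T.points with hz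
  set r := inradius T with hr_def
  -- values and derivatives along the edges
  have hb : ∀ c i, quad (a c i) (z (i + 1)) = 0 ∧ quad (a c i) (z (i + 2)) = 0 ∧
      dotp (quadGrad (a c i) (z (i + 1))) (z (i + 2) - z (i + 1)) = 0 ∧
      dotp (quadGrad (a c i) (z (i + 2))) (z (i + 2) - z (i + 1)) = 0 :=
    fun c i => quad_eq_zero_of_segment (hbd c i)
  have hi : ∀ c j, quad (a c (j + 1)) o = quad (a c (j + 2)) o ∧
      dotp (quadGrad (a c (j + 1)) (z j)) (o - z j) =
        dotp (quadGrad (a c (j + 2)) (z j)) (o - z j) := by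
    intro c j
    obtain ⟨-, h2, h3, -⟩ := quad_eq_zero_of_segment (a := a c (j + 1) - a c (j + 2)) (x := z j)
      (y := o) fun s hs0 hs1 => by rw [quad_sub, hint c j s hs0 hs1, sub_self]
    rw [quad_sub] at h2
    rw [quadGrad_sub, dotp_sub_left] at h3
    exact ⟨sub_eq_zero.1 h2, sub_eq_zero.1 h3⟩
  have ho0 : ∀ c i, quad (a c i) o = quad (a c 0) o := by
    intro c i
    have h1 := (hi c 1).1
    have h2 := (hi c 2).1
    simp only [Fin.isValue, show (1 : Fin 3) + 1 = 2 from rfl, show (1 : Fin 3) + 2 = 0 from rfl,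
      show (2 : Fin 3) + 1 = 0 from rfl, show (2 : Fin 3) + 2 = 1 from rfl] at h1 h2
    fin_cases i
    · rfl
    · exact h2.symm
    · exact h1
  -- The vertex estimate carries the weight `|cross| / 24 = r hᵢ / 24`.
  set E : ℝ := 24 * I / r with hE
  have hE0 : 0 ≤ E := by positivity
  have hq : ∀ i x, (x = o ∨ x = z (i + 1) ∨ x = z (i + 2)) →
      edgeLength T i * rowTrace (fun c => quadGrad (a c i) x) ^ 2 ≤ E := by
    intro i x hx
    have h1 := sq_vertex_le_lintegral (cross_incenter_ne_zero T i)
      (F := fun x => rowTrace (fun c => quadGrad (a c i) x)) (by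
        intro α β
        simp only [rowTrace, quadGrad_affine, PiLp.add_apply, PiLp.smul_apply, PiLp.sub_apply,
          smul_eq_mul]
        ring) hx
    have h2 := (ENNReal.ofReal_le_ofReal_iff hI0).1 (h1.trans (hI i))
    rw [abs_cross_incenter] at h2
    rw [hE, le_div_iff₀ hr]
    linarith
  have core := clough_tocher_core z o (edgeLength T) (tangentLength T)
    (S := trianglePerimeter T / 2) (H := longestEdge T) hr (tangentLength_pos T) hE0
    (semiperimeter_eq T) (edgeLength_eq T) (inradius_sq_mul T) hK (nsq_incenter_sub T)
    (fun i => (edgeLength_sq T i).symm) (fun i => by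
      have h := abs_cross_incenter T i
      rw [← mul_pow, ← h, sq_abs]
      simp only [cross, PiLp.sub_apply, ho, hz]; ring) (fun i => by
      have h : cross (z (i + 2) - z (i + 1)) (z i - z (i + 2)) = signedArea2 T := by
        rw [← cross_points T i]; simp only [cross, PiLp.sub_apply, hz]; ring
      have hP := trianglePerimeter_pos T
      rw [h, hr_def, inradius, div_pow, sq_abs]
      field_simp
      ring)
    (edgeLength_le_longestEdge T)
    -- All pieces agree at the incenter, so piece 0 serves. The spoke derivative at `z j` is read
    -- from `K (j + 1)`, and agrees with that from `K (j + 2)` by continuity.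
    (WithLp.toLp 2 fun c => quad (a c 0) o)
    (fun j => WithLp.toLp 2 fun c => dotp (quadGrad (a c (j + 1)) (z j)) (o - z j))
    (fun i c => quadGrad (a c i) (z (i + 1))) (fun i c => quadGrad (a c i) (z (i + 2)))
    (fun i c => quadGrad (a c i) o)
    (fun i c => by
      have := (hi c (i + 1)).2
      obtain ⟨e1, e2, e3, e4⟩ := fin3_add i
      rw [e2] at this
      exact this.symm)
    (fun i c => (hb c i).2.2.1)
    (fun i c => by
      obtain ⟨e1, e2, e3, e4⟩ := fin3_add i
      simp only [e3])
    (fun i c => (hb c i).2.2.2)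
    (fun i c => by
      have h1 := quad_sub_quad (a c i) (z (i + 1)) o
      have h2 := (hi c (i + 1)).2
      obtain ⟨e1, e2, e3, e4⟩ := fin3_add i
      rw [e2] at h2
      rw [(hb c i).1, ho0 c i] at h1
      show _ = 2 * quad (a c 0) o - dotp (quadGrad (a c (i + 1 + 1)) (z (i + 1))) (o - z (i + 1))
      linarith)
    (fun i c => by
      have h1 := quad_sub_quad (a c i) (z (i + 2)) o
      obtain ⟨e1, e2, e3, e4⟩ := fin3_add i
      rw [(hb c i).2.1, ho0 c i] at h1
      show _ = 2 * quad (a c 0) o - dotp (quadGrad (a c (i + 2 + 1)) (z (i + 2))) (o - z (i + 2))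
      rw [e3]
      linarith)
    (fun i => hq i _ (Or.inr (Or.inl rfl))) (fun i => hq i _ (Or.inr (Or.inr rfl)))
    (fun i => hq i _ (Or.inl rfl)) i
  obtain ⟨cA, cB, c0⟩ := core
  have hC := one_le_coreConst hK0
  set H := longestEdge T
  set M : ℝ := rowNsq (fun c => quadGrad (a c i) o) +
    rowNsq (fun c => quadGrad (a c i) (z (i + 1))) +
    rowNsq (fun c => quadGrad (a c i) (z (i + 2))) with hM
  have hM0 : 0 ≤ M := add_nonneg (add_nonneg (rowNsq_nonneg _) (rowNsq_nonneg _)) (rowNsq_nonneg _)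
  have hbound : ∀ x ∈ splitTriangle T i, rowNsq (fun c => quadGrad (a c i) x) ≤ M := by
    intro x hx
    obtain ⟨α, β, hα, hβ, hαβ, rfl⟩ := mem_convexHull_triple.1 hx
    simp only [rowNsq, quadGrad_affine, hM]
    have h0 := nsq_convexCombination_le (p := quadGrad (a 0 i) o)
      (q := quadGrad (a 0 i) (z (i + 1))) (s := quadGrad (a 0 i) (z (i + 2))) hα hβ hαβ
    have h1 := nsq_convexCombination_le (p := quadGrad (a 1 i) o)
      (q := quadGrad (a 1 i) (z (i + 1))) (s := quadGrad (a 1 i) (z (i + 2))) hα hβ hαβ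
    linarith
  have hvol : volume (splitTriangle T i) = ENNReal.ofReal (r * edgeLength T i / 2) := by
    rw [splitTriangle, volume_convexHull_triple (cross_incenter_ne_zero T i), abs_cross_incenter]
  calc ∫⁻ x in splitTriangle T i, ENNReal.ofReal (rowNsq fun c => quadGrad (a c i) x)
      ≤ ∫⁻ _ in splitTriangle T i, ENNReal.ofReal M :=
        setLIntegral_mono measurable_const fun x hx => ENNReal.ofReal_le_ofReal (hbound x hx)
    _ = ENNReal.ofReal (M * (r * edgeLength T i / 2)) := by
        rw [setLIntegral_const, hvol, ENNReal.ofReal_mul hM0]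
    _ ≤ _ := by
        apply ENNReal.ofReal_le_ofReal
        have hEH : 0 ≤ E * H ^ 2 := by positivity
        -- The vertex bounds have constant 1 and are absorbed by `1 ≤ coreConst K`. With area `r hᵢ
        -- / 2`, `E = 24 I / r` and `ϱ_T = H / (2 r)`, the final constant is `3 · 24 / 2 · 4 = 144`.
        have h3 : edgeLength T i * M * r ^ 2 ≤ 3 * (coreConst K * E * H ^ 2) := by
          have := mul_le_mul_of_nonneg_right hC hEH
          rw [hM]
          linarith
        have h4 : M * (r * edgeLength T i / 2) = edgeLength T i * M * r ^ 2 / (2 * r) := by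
          field_simp
        rw [h4, div_le_iff₀ (by positivity)]
        refine h3.trans (le_of_eq ?_)
        rw [aspectRatio_eq, hE, ← hr_def]
        field_simp
        ring

theorem mainTheorem3 :
    ∀ δ : ℝ, 0 < δ → ∃ C : ℝ, 0 < C ∧
      ∀ T : Affine.Triangle ℝ Plane, LargeAngleCondition δ T →
        ∀ v ∈ conformingPolyZeroVec 2 (cloughTocher T (triangleIncenter T)),
          ∀ G : Fin 2 → Plane → Plane,
            (∀ i : Fin 2, HasWeakGradient (interior (triangleSet T)) (fun x => v x i) (G i)) →
              gradL2Norm (triangleSet T) G ≤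
                ENNReal.ofReal (C * aspectRatio T) * divL2Norm (triangleSet T) G := by
  intro δ hδ
  set K : ℝ := √(2 / (1 - Real.cos δ)) with hK
  have hK0 : 0 ≤ K := Real.sqrt_nonneg _
  have hC1 := one_le_coreConst hK0
  -- `432 = 3 · 144`, since each of the three pieces is bounded by the divergence on the whole
  -- triangle.
  refine ⟨√(432 * coreConst K), Real.sqrt_pos.2 (by linarith), fun T hT v hv G hG => ?_⟩
  choose a ha1 ha2 ha3 using fun c => exists_quad_of_mem_conformingPolyZero T (hv c)
  have hGa : ∀ c i, ∀ᵐ x : Plane, x ∈ splitTriangle T i → G c x = quadGrad (a c i) x :=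
    fun c i => weak_gradient_ae_eq_quadGrad (hG c) (ha1 c i)
  have hmK : ∀ i, MeasurableSet (splitTriangle T i) :=
    fun i => (isClosed_splitTriangle T i).measurableSet
  have hϱ : 0 < aspectRatio T := by
    rw [aspectRatio_eq]
    have := edgeLength_le_longestEdge T 0
    have := edgeLength_pos T 0
    have := inradius_pos T
    exact div_pos (by linarith) (by linarith)
  have hC0 : 0 < √(432 * coreConst K) * aspectRatio T :=
    mul_pos (Real.sqrt_pos.2 (by linarith)) hϱ
  have hgrad : gradL2Norm (triangleSet T) G ^ (2 : ℝ) =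
      ∫⁻ x in triangleSet T, ENNReal.ofReal (rowNsq fun c => G c x) := by
    rw [gradL2Norm]
    have := eLpNorm_nnreal_pow_eq_lintegral (μ := volume.restrict (triangleSet T)) (p := 2)
      (f := fun x => (WithLp.toLp 2 fun i => G i x : PiLp 2 fun _ : Fin 2 => Plane)) (by norm_num)
    simp only [NNReal.coe_ofNat, ENNReal.coe_ofNat] at this
    rw [this]
    refine lintegral_congr fun x => ?_
    rw [← ofReal_norm, ENNReal.ofReal_rpow_of_nonneg (norm_nonneg _) (by norm_num)]
    congr 1
    rw [Real.rpow_two, PiLp.norm_sq_eq_of_L2, Fin.sum_univ_two, rowNsq]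
    simp [EuclideanSpace.norm_sq_eq, nsq]
  have hdiv : divL2Norm (triangleSet T) G ^ (2 : ℝ) =
      ∫⁻ x in triangleSet T, ENNReal.ofReal (rowTrace (fun c => G c x) ^ 2) := by
    rw [divL2Norm]
    have := eLpNorm_nnreal_pow_eq_lintegral (μ := volume.restrict (triangleSet T)) (p := 2)
      (f := fun x => ∑ i : Fin 2, G i x i) (by norm_num)
    simp only [NNReal.coe_ofNat, ENNReal.coe_ofNat] at this
    rw [this]
    refine lintegral_congr fun x => ?_
    rw [← ofReal_norm, ENNReal.ofReal_rpow_of_nonneg (norm_nonneg _) (by norm_num)]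
    congr 1
    rw [Real.rpow_two, Real.norm_eq_abs, sq_abs, Fin.sum_univ_two, rowTrace]
  refine (ENNReal.rpow_le_rpow_iff (show (0 : ℝ) < 2 by norm_num)).1 ?_
  rw [ENNReal.mul_rpow_of_nonneg _ _ (by norm_num), hgrad, hdiv]
  -- An infinite right-hand side is dismissed here, so finiteness of the divergence norm need not be
  -- proved.
  by_cases htop : ∫⁻ x in triangleSet T, ENNReal.ofReal (rowTrace (fun c => G c x) ^ 2) = ⊤
  · rw [htop, ENNReal.mul_top]
    · exact le_top
    · exact (ENNReal.rpow_pos (ENNReal.ofReal_pos.2 hC0) ENNReal.ofReal_ne_top).ne'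
  set I : ℝ := (∫⁻ x in triangleSet T, ENNReal.ofReal (rowTrace (fun c => G c x) ^ 2)).toReal
    with hI
  have hI0 : 0 ≤ I := ENNReal.toReal_nonneg
  rw [← ENNReal.ofReal_toReal htop, ← hI]
  have hpiece := lintegral_rowNsq_le T hK0 (inradius_le_of_largeAngleCondition T hδ hT) a ha2 ha3
    hI0 (fun i => by
      rw [hI, ENNReal.ofReal_toReal htop]
      refine le_trans (le_of_eq ?_) (lintegral_mono_set (splitTriangle_subset T i))
      refine lintegral_congr_ae ((ae_restrict_iff' (hmK i)).2 ?_)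
      filter_upwards [hGa 0 i, hGa 1 i] with x h0 h1 hx
      rw [rowTrace, rowTrace, h0 hx, h1 hx])
  calc ∫⁻ x in triangleSet T, ENNReal.ofReal (rowNsq fun c => G c x)
      ≤ ∑ i, ∫⁻ x in splitTriangle T i, ENNReal.ofReal (rowNsq fun c => G c x) := by
        rw [triangleSet_eq_iUnion, ← tsum_fintype (L := .unconditional _)]
        exact lintegral_iUnion_le _ _
    _ ≤ ∑ _i : Fin 3, ENNReal.ofReal (144 * coreConst K * aspectRatio T ^ 2 * I) := by
        refine Finset.sum_le_sum fun i _ => le_trans (le_of_eq ?_) (hpiece i)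
        refine lintegral_congr_ae ((ae_restrict_iff' (hmK i)).2 ?_)
        filter_upwards [hGa 0 i, hGa 1 i] with x h0 h1 hx
        rw [rowNsq, rowNsq, h0 hx, h1 hx]
    _ = ENNReal.ofReal (√(432 * coreConst K) * aspectRatio T) ^ (2 : ℝ) * ENNReal.ofReal I := by
        rw [ENNReal.ofReal_rpow_of_nonneg hC0.le (by norm_num), ← ENNReal.ofReal_mul (by positivity),
          ← ENNReal.ofReal_sum_of_nonneg (fun _ _ => by positivity)]
        congr 1
        simp only [Real.rpow_two, mul_pow, Real.sq_sqrt (by linarith : 0 ≤ 432 * coreConst K),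
          Fin.sum_univ_three]
        ring
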